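/- **Theorem (unknown-mean Gaussian case).** Let $V$ and $U$ be non-zero finite-dimensional real Euclidean spaces, $p=\dim V$, $q=\dim U$. Write $\mathcal P(V)$ for the set of positive definite self-adjoint operators on $V$, give $V\otimes U$ its induced scalar product, and let $$\mathcal M_{\mathcal N}=\{P\otimes Q : P\in\mathcal P(V),\ Q\in\mathcal P(U)\}\subset \mathcal P(V\otimes U)$$ with the subspace topology, and $S=(V\otimes U)\times\mathcal M_{\mathcal N}$. Let $X=(X_1,\dots,X_n)$ be random vectors in $V\otimes U$, not necessarily independent or identically distributed, whose joint distribution on $(V\otimes U)^n$ is absolutely continuous with respect to Lebesgue measure, and suppose $$n>1+\frac pq+\frac qp .$$ For $(M,\Theta)\in S$ let $$f_{\mathcal N}(M,\Theta;X)=\frac1n\sum_{i=1}^n\bigl(\Theta(X_i-M),\,X_i-M\bigr)-\ln\det\Theta ,$$ which, up to scaling and an additive constant, is the Gaussian negative log-likelihood with mean $M$ and inverse covariance $\Theta=P\otimes Q$. Then, almost surely: 1. the extension of $f_{\mathcal N}(\cdot\,;X)$ by the value $+\infty$ at the point at infinity is a continuous function from the one-point compactification $S\sqcup\{\infty\}$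 to $[-\infty,+\infty]$; 2. $f_{\mathcal N}(\cdot\,;X)$ has a unique minimizer over $S$, i.e. there is exactly one $(\widehat M,\widehat\Theta)\in S$ with $f_{\mathcal N}(\widehat M,\widehat\Theta;X)\le f_{\mathcal N}(M,\Theta;X)$ for all $(M,\Theta)\in S$. -/

import Mathlib

open MeasureTheory
open scoped TensorProduct

noncomputable section

section KroneckerLikelihood

variable {V U : Type*}
  [NormedAddCommGroup V] [InnerProductSpace ℝ V]
  [NormedAddCommGroup U] [InnerProductSpace ℝ U]

/-- The open cone `𝒫(V)` of positive definite (in particular self-adjoint) operators on a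
real Euclidean space. -/
def posDefOperators (V : Type*) [NormedAddCommGroup V] [InnerProductSpace ℝ V] :
    Set (V →L[ℝ] V) :=
  {T | (T : V →ₗ[ℝ] V).IsSymmetric ∧ ∀ v : V, v ≠ 0 → 0 < inner ℝ (T v) v}

/-- The set `ℳ_𝒩` of all Kronecker products `P ⊗ Q` of positive definite operators `P` on `V` and
`Q` on `U`, as a subset of the space of operators on `V ⊗ U` (from which, as a subtype, it takes
its topology). -/
def kroneckerCone (V U : Type*)
    [NormedAddCommGroup V] [InnerProductSpace ℝ V]
    [NormedAddCommGroup U] [InnerProductSpace ℝ U] :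
    Set (V ⊗[ℝ] U →L[ℝ] V ⊗[ℝ] U) :=
  {T | ∃ P ∈ posDefOperators V, ∃ Q ∈ posDefOperators U, T = TensorProduct.mapL P Q}

/-- The Gaussian negative log-likelihood (up to additive constant and scaling) with unknown mean `M`
and inverse covariance `Θ = P ⊗ Q`, as a function on `S = (V ⊗ U) × ℳ_𝒩`:
`f(M, Θ; x) = (1/n) ∑ᵢ ⟪Θ (xᵢ - M), xᵢ - M⟫ - ln det Θ`.
With `V ⊗ U` identified with matrices, `⟪(P ⊗ Q) Y, Y⟫ = Tr (P Y Q Yᵀ)`. -/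
def gaussianNLL {n : ℕ} (x : Fin n → V ⊗[ℝ] U)
    (s : (V ⊗[ℝ] U) × kroneckerCone V U) : ℝ :=
  (1 / (n : ℝ)) * ∑ i, inner ℝ ((s.2 : V ⊗[ℝ] U →L[ℝ] V ⊗[ℝ] U) (x i - s.1)) (x i - s.1)
    - Real.log (s.2 : V ⊗[ℝ] U →L[ℝ] V ⊗[ℝ] U).det

end KroneckerLikelihood

/-- The extension of a real function on `S` to the one-point compactification of `S`, with values
in the two-point compactification of `ℝ`, by the value `+∞` at the point at infinity. -/
def extendByTop {S : Type*} (f : S → ℝ) (z : OnePoint S) : EReal :=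
  z.elim ⊤ fun s => (f s : EReal)

/-- A finite family of random vectors in a Euclidean space `E` is jointly (mutually) continuous:
its joint law on `Eⁿ` is absolutely continuous with respect to Lebesgue measure. -/
def JointlyContinuous {Ω E : Type*} [MeasurableSpace Ω] [NormedAddCommGroup E]
    [InnerProductSpace ℝ E] [FiniteDimensional ℝ E] [MeasurableSpace E] [BorelSpace E]
    {n : ℕ} (X : Fin n → Ω → E) (μ : Measure Ω) : Prop :=
  AEMeasurable (fun ω i => X i ω) μ ∧
    μ.map (fun ω i => X i ω) ≪ (volume : Measure (Fin n → E))

end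

/-! Completing the square puts the optimal mean at the sample mean, since Θ is positive definite. If
P and Q are diagonal in bases `e`, `f` with entries exp a_i and exp b_j, the profiled likelihood is,
up to a constant depending on the bases, Σ (c_ij exp(a_i + b_j) - (a_i + b_j)), where c_ij is the
mean squared coefficient of the centred sample along e_i ⊗ f_j. Everything depends on where c
vanishes: the sample is stable when, in all bases, every empty rectangle I × J has |I|/p + |J|/q <
1.

Coercivity: under this condition Hall's marriage theorem rewrites the sum of all exponents as one
arbitrary cell plus pq - 1 cells with c ≠ 0. The exponentials control the latter, and the spare cell
gives a two-sided bound (`exists_bound_of_strictHall`). Compactness of orthonormal frames makes the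
bound uniform (`IsStableTuple.exists_uniform`).

Uniqueness: two minimizers are diagonalized simultaneously by congruence and compared with their
geodesic midpoint. Strict convexity forces a_i + b_j = 0 where c_ij ≠ 0, and the Hall condition
spreads this to all cells (`eq_of_forall_gaussianNLL_le`).

Genericity: unstable samples lie in finitely many C¹ images of spaces of dimension below npq; the
sample-size hypothesis is exactly what the count needs (`chart_dimension_lt`, `ae_isStableTuple`).
-/

noncomputable section

/-! ### Strict Hall relations and matchings -/

/-- A bipartite relation between `ι` and `κ` satisfies the strict (weighted) Hall condition if
every nonempty rectangle `I × J` that avoids it satisfies `|I| / |ι| + |J| / |κ| < 1`. -/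
def StrictHall {ι κ : Type*} [Fintype ι] [Fintype κ] (R : ι → κ → Prop) : Prop :=
  ∀ (I : Finset ι) (J : Finset κ), I.Nonempty → J.Nonempty → (∀ i ∈ I, ∀ j ∈ J, ¬ R i j) →
    I.card * Fintype.card κ + J.card * Fintype.card ι < Fintype.card ι * Fintype.card κ

namespace StrictHall

variable {ι κ : Type*} [Fintype ι] [Fintype κ] {R : ι → κ → Prop}

theorem exists_right [Nonempty κ] (h : StrictHall R) (i : ι) : ∃ j, R i j := by
  by_contra! hc
  have := h {i} Finset.univ (by simp) (by simp) (by simpa using hc)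
  rw [Finset.card_univ, mul_comm (Fintype.card κ)] at this
  omega

theorem exists_left [Nonempty ι] (h : StrictHall R) (j : κ) : ∃ i, R i j := by
  by_contra! hc
  have := h Finset.univ {j} (by simp) (by simp) (by simpa using hc)
  rw [Finset.card_univ] at this
  omega

/-- After deleting any one cell, the strict Hall condition still provides a perfect matching of
`|κ|` copies of each row with `|ι|` copies of each column. -/
theorem exists_perm (h : StrictHall R) (x₀ : ι × κ) :
    ∃ σ : Equiv.Perm {x : ι × κ // x ≠ x₀}, ∀ x, R x.1.1 (σ x).1.2 := by
  classical
  let t : {x : ι × κ // x ≠ x₀} → Finset {x : ι × κ // x ≠ x₀} := fun x =>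
    Finset.univ.filter fun y => R x.1.1 y.1.2
  have key : ∀ s : Finset {x : ι × κ // x ≠ x₀}, s.card ≤ (s.biUnion t).card := by
    intro s
    rcases s.eq_empty_or_nonempty with rfl | hs
    · simp
    let I : Finset ι := s.image fun x => x.1.1
    let N : Finset κ := Finset.univ.filter fun j => ∃ i ∈ I, R i j
    have hbi : s.biUnion t = Finset.univ.filter fun y => y.1.2 ∈ N := by
      ext y
      simp [t, N, I]
    -- The deleted cell may lie in a neighbouring column, hence the -1; strictness of the Hall
    -- inequality pays for it below.
    have hcard : Fintype.card ι * N.card - 1 ≤ (s.biUnion t).card := by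
      have h1 : (s.biUnion t).map (Function.Embedding.subtype _) =
          ((Finset.univ : Finset ι) ×ˢ N).erase x₀ := by
        ext y
        rw [hbi]
        simp [and_comm]
      rw [← Finset.card_map (Function.Embedding.subtype _), h1]
      refine le_trans ?_ Finset.pred_card_le_card_erase
      rw [Finset.card_product, Finset.card_univ]
    have hI : s.card ≤ I.card * Fintype.card κ := by
      rw [← Finset.card_univ (α := κ), ← Finset.card_product, ← Finset.card_map
        (Function.Embedding.subtype _)]
      apply Finset.card_le_card
      intro y hy
      simp only [Finset.mem_map, Function.Embedding.subtype_apply] at hy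
      obtain ⟨a, ha, rfl⟩ := hy
      simp only [Finset.mem_product, Finset.mem_univ, and_true, I, Finset.mem_image]
      exact ⟨a, ha, rfl⟩
    by_cases hN : Nᶜ.Nonempty
    · have := h I Nᶜ (hs.image _) hN (by
        intro i hi j hj hR
        simp only [Finset.mem_compl, N, Finset.mem_filter, Finset.mem_univ, true_and] at hj
        exact hj ⟨i, hi, hR⟩)
      have hc : N.card + Nᶜ.card = Fintype.card κ := Finset.card_add_card_compl N
      have : I.card * Fintype.card κ < Fintype.card ι * N.card := by
        have h2 : Fintype.card ι * Fintype.card κ =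
          Fintype.card ι * N.card + Nᶜ.card * Fintype.card ι := by rw [← hc]; ring
        omega
      omega
    · have hN' : N = Finset.univ := by
        rw [Finset.not_nonempty_iff_eq_empty, Finset.compl_eq_empty_iff] at hN
        exact hN
      refine le_trans ?_ hcard
      rw [hN', Finset.card_univ, ← Fintype.card_prod]
      refine (Finset.card_le_univ s).trans ?_
      rw [Fintype.card_subtype_compl, Fintype.card_subtype_eq]
  obtain ⟨f, hf, hft⟩ := (Finset.all_card_le_biUnion_card_iff_exists_injective t).1 key
  refine ⟨Equiv.ofBijective f (Finite.injective_iff_bijective.1 hf), fun x => ?_⟩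
  simpa [t] using hft x

/-- The total weight of all cells splits into one prescribed cell and cells in the relation. -/
theorem exists_sum_eq [DecidableEq ι] [DecidableEq κ] (h : StrictHall R) (x₀ : ι × κ)
    (a : ι → ℝ) (b : κ → ℝ) :
    ∃ σ : {x : ι × κ // x ≠ x₀} → ι × κ, (∀ x, R (σ x).1 (σ x).2) ∧
      ∑ x : ι × κ, (a x.1 + b x.2) =
        a x₀.1 + b x₀.2 + ∑ x, (a (σ x).1 + b (σ x).2) := by
  obtain ⟨σ, hσ⟩ := h.exists_perm x₀
  refine ⟨fun x => (x.1.1, (σ x).1.2), hσ, ?_⟩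
  rw [Fintype.sum_eq_add_sum_subtype_ne _ x₀]
  congr 1
  rw [Finset.sum_add_distrib, Finset.sum_add_distrib]
  congr 1
  exact (Equiv.sum_comp σ fun x => b x.1.2).symm

/-- The only separable weight that vanishes on a strict Hall relation is zero. -/
theorem add_eq_zero [Nonempty ι] [Nonempty κ] (h : StrictHall R) (a : ι → ℝ) (b : κ → ℝ)
    (hab : ∀ i j, R i j → a i + b j = 0) (i : ι) (j : κ) : a i + b j = 0 := by
  classical
  -- The spare cell is arbitrary, so every cell has the same weight, namely the total; each row also
  -- contains a related cell, of weight zero.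
  have key : ∀ x : ι × κ, ∑ x : ι × κ, (a x.1 + b x.2) = a x.1 + b x.2 := by
    intro x
    obtain ⟨σ, hσ, hs⟩ := h.exists_sum_eq x a b
    rw [hs, Finset.sum_eq_zero fun x _ => hab _ _ (hσ x), add_zero]
  obtain ⟨j', hj'⟩ := h.exists_right i
  rw [← key (i, j), key (i, j')]
  exact hab _ _ hj'

end StrictHall

/-! ### Coercivity of separable exponential sums -/

theorem one_add_log_le_mul_exp_sub {η : ℝ} (hη : 0 < η) (t : ℝ) :
    1 + Real.log η ≤ η * Real.exp t - t := by
  have := Real.add_one_le_exp (t + Real.log η)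
  rw [Real.exp_add, Real.exp_log hη] at this
  linarith

section Coercive

variable (ι κ : Type*) [Fintype ι] [Fintype κ] [Nonempty ι] [Nonempty κ]

/-- Uniform coercivity of `∑ c i j exp (a i + b j) - ∑ (a i + b j)` on separable exponents, as
long as the large coefficients `c i j` form a strict Hall relation. -/
theorem exists_bound_of_strictHall {δ : ℝ} (hδ : 0 < δ) (A : ℝ) :
    ∃ C : ℝ, ∀ (c : ι → κ → ℝ), (∀ i j, 0 ≤ c i j) → StrictHall (fun i j => δ ≤ c i j) →
      ∀ (a : ι → ℝ) (b : κ → ℝ),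
        - C ≤ ∑ x : ι × κ, (c x.1 x.2 * Real.exp (a x.1 + b x.2) - (a x.1 + b x.2)) ∧
        (∑ x : ι × κ, (c x.1 x.2 * Real.exp (a x.1 + b x.2) - (a x.1 + b x.2)) ≤ A →
          ∀ i j, |a i + b j| ≤ C) := by
  classical
  set N : ℕ := Fintype.card (ι × κ) with hN
  have hN0 : 0 < N := Fintype.card_pos
  have hN1 : (0 : ℝ) < N := by exact_mod_cast hN0
  -- Dividing by N lets each of the N cells be charged an equal share S / N of the exponential sum.
  set η : ℝ := δ / N with hη
  have hη0 : 0 < η := by positivity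
  set L : ℝ := 1 + Real.log η with hL
  set c1 : ℝ := A - (N - 1) * L with hc1
  -- Twice the scalar inequality at η / 2 reads η exp t - t ≥ t + 2 (1 + log (η / 2)), which turns a
  -- bound `c1` on the left into an upper bound on t.
  set c2 : ℝ := c1 - 2 * (1 + Real.log (η / 2)) with hc2
  refine ⟨max (max (-(N * L)) (2 * |c1| + 2 * |c2|)) 0, ?_⟩
  intro c hc0 hR a b
  set S : ℝ := ∑ x : ι × κ, c x.1 x.2 * Real.exp (a x.1 + b x.2) with hS
  set T : ℝ := ∑ x : ι × κ, (a x.1 + b x.2) with hT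
  have hST : ∑ x : ι × κ, (c x.1 x.2 * Real.exp (a x.1 + b x.2) - (a x.1 + b x.2)) = S - T :=
    Finset.sum_sub_distrib _ _
  rw [hST]
  have hS0 : 0 ≤ S := Finset.sum_nonneg fun x _ => mul_nonneg (hc0 _ _) (Real.exp_pos _).le
  have hE : ∀ x : ι × κ, δ ≤ c x.1 x.2 → η * Real.exp (a x.1 + b x.2) ≤ S / N := by
    intro x hx
    rw [hη, div_mul_eq_mul_div]
    gcongr
    refine (mul_le_mul_of_nonneg_right hx (Real.exp_pos _).le).trans ?_
    exact Finset.single_le_sum (f := fun x : ι × κ => c x.1 x.2 * Real.exp (a x.1 + b x.2))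
      (fun x _ => mul_nonneg (hc0 _ _) (Real.exp_pos _).le) (Finset.mem_univ x)
  have hmain : ∀ x : ι × κ, (N - 1) * L + (S / N - (a x.1 + b x.2)) ≤ S - T := by
    intro x
    obtain ⟨σ, hσ, hs⟩ := hR.exists_sum_eq x a b
    have h1 : ∀ y, a (σ y).1 + b (σ y).2 ≤ S / N - L := by
      intro y
      have h2 := hE (σ y) (hσ y)
      have h3 := one_add_log_le_mul_exp_sub hη0 (a (σ y).1 + b (σ y).2)
      linarith
    have h4 : ∑ y, (a (σ y).1 + b (σ y).2) ≤ (N - 1) * (S / N - L) := by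
      refine (Finset.sum_le_card_nsmul _ _ _ fun y _ => h1 y).trans ?_
      rw [Finset.card_univ, Fintype.card_subtype_compl, Fintype.card_subtype_eq, nsmul_eq_mul,
        ← hN, Nat.cast_sub hN0, Nat.cast_one]
    have h5 : S = N * (S / N) := by field_simp
    rw [hT, hs]
    nlinarith
  have hbE : ∀ x : ι × κ, δ ≤ c x.1 x.2 →
      (N - 1) * L + (η * Real.exp (a x.1 + b x.2) - (a x.1 + b x.2)) ≤ S - T := fun x hx => by
    have := hmain x
    have := hE x hx
    linarith
  refine ⟨?_, fun hA => ?_⟩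
  · obtain ⟨i⟩ := ‹Nonempty ι›
    obtain ⟨j, hj⟩ := hR.exists_right i
    have h1 := hbE (i, j) hj
    have h2 := one_add_log_le_mul_exp_sub hη0 (a i + b j)
    have h3 : -(N * L) ≤ max (max (-(N * L)) (2 * |c1| + 2 * |c2|)) 0 :=
      (le_max_left _ _).trans (le_max_left _ _)
    simp only at h1
    linarith
  · have hlow : ∀ i j, - c1 ≤ a i + b j := by
      intro i j
      have h1 := hmain (i, j)
      have h2 : 0 ≤ S / N := by positivity
      simp only at h1
      linarith
    have hup : ∀ i j, δ ≤ c i j → a i + b j ≤ c2 := by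
      intro i j hij
      have h1 := hbE (i, j) hij
      have h2 := one_add_log_le_mul_exp_sub (half_pos hη0) (a i + b j)
      simp only at h1
      linarith
    intro i j
    refine le_trans ?_ ((le_max_right _ _).trans (le_max_left _ _))
    -- The upper bound holds only on related cells; separability extends it through a_i + b_j = (a_i
    -- + b_j') + (a_i' + b_j) - (a_i' + b_j').
    obtain ⟨j', hj'⟩ := hR.exists_right i
    obtain ⟨i', hi'⟩ := hR.exists_left j
    have h1 := hup _ _ hj'
    have h2 := hup _ _ hi'
    have h3 := hlow i' j'
    have h4 := hlow i j
    rw [abs_le]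
    have := le_abs_self c1
    have := le_abs_self c2
    have := abs_nonneg c1
    have := abs_nonneg c2
    constructor <;> linarith

end Coercive

/-! ### Null images, echelon families and stability -/

section NullRange

open Module

/-- A Haar measure on a finite-dimensional space vanishes on sets of small Hausdorff dimension. -/
theorem addHaar_eq_zero_of_dimH_lt_finrank {F : Type*} [NormedAddCommGroup F] [NormedSpace ℝ F]
    [FiniteDimensional ℝ F] [MeasurableSpace F] [BorelSpace F] (μ : Measure F)
    [μ.IsAddHaarMeasure] {s : Set F} (hs : dimH s < finrank ℝ F) : μ s = 0 := by
  let L : F ≃L[ℝ] (Fin (finrank ℝ F) → ℝ) := ContinuousLinearEquiv.ofFinrankEq (by simp)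
  have hmap : μ s = μ.map L (L '' s) := by
    have := L.toHomeomorph.measurableEmbedding.map_apply μ (L '' s)
    rw [show (L.toHomeomorph : F → _) = L from rfl, Set.preimage_image_eq s L.injective] at this
    exact this.symm
  have hac : μ.map L ≪ (volume : Measure (Fin (finrank ℝ F) → ℝ)) := by
    rw [Measure.isAddLeftInvariant_eq_smul (μ.map L) volume]
    exact Measure.smul_absolutelyContinuous
  rw [hmap]
  apply hac
  rw [← hausdorffMeasure_pi_real]
  have := hausdorffMeasure_of_dimH_lt (s := L '' s) (d := (finrank ℝ F : NNReal)) (by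
    rw [L.dimH_image]
    exact_mod_cast hs)
  simpa using this

/-- The range of a `C¹` map from a space of smaller dimension is a null set. -/
theorem ContDiff.addHaar_range_eq_zero {D F : Type*} [NormedAddCommGroup D] [NormedSpace ℝ D]
    [FiniteDimensional ℝ D] [NormedAddCommGroup F] [NormedSpace ℝ F]
    [FiniteDimensional ℝ F] [MeasurableSpace F] [BorelSpace F] (μ : Measure F)
    [μ.IsAddHaarMeasure] {g : D → F} (hg : ContDiff ℝ 1 g) (hDF : finrank ℝ D < finrank ℝ F) :
    μ (Set.range g) = 0 :=
  addHaar_eq_zero_of_dimH_lt_finrank μ (hg.dimH_range_le.trans_lt (by exact_mod_cast hDF))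

end NullRange

/-- Every subspace contains, relative to a given basis, a family in reduced echelon form. -/
theorem Submodule.exists_echelon {V ι : Type*} [AddCommGroup V] [Module ℝ V]
    [Fintype ι] [DecidableEq ι] (v : Module.Basis ι ℝ V) (W : Submodule ℝ V) :
    ∃ (I : Finset ι) (d : ι → ι → ℝ), I.card = Module.finrank ℝ W ∧
      (∀ i l, ¬ (i ∈ I ∧ l ∉ I) → d i l = 0) ∧
      ∀ i ∈ I, v i + ∑ l, d i l • v l ∈ W := by
  have : FiniteDimensional ℝ V := v.finiteDimensional_of_finite
  -- Some basis vectors project to a basis of the quotient by W. Each remaining one is congruent mod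
  -- W to a combination of these, and the remaining indices form I.
  obtain ⟨κ, a, ha, hsp, hli⟩ := exists_linearIndependent' ℝ (W.mkQ ∘ v)
  have hfin : Finite κ := Finite.of_injective a ha
  have := Fintype.ofFinite κ
  have htop : Submodule.span ℝ (Set.range ((W.mkQ ∘ v) ∘ a)) = ⊤ := by
    rw [hsp, Set.range_comp, Submodule.span_image, v.span_eq, Submodule.map_top,
      Submodule.range_mkQ]
  have hcard : Fintype.card κ = Module.finrank ℝ (V ⧸ W) := by
    rw [← finrank_top ℝ (V ⧸ W), ← htop, finrank_span_eq_card hli]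
  set K : Finset ι := Finset.univ.image a with hK
  have hKc : K.card = Fintype.card κ := by
    rw [hK, Finset.card_image_of_injective _ ha, Finset.card_univ]
  have hex : ∀ i : ι, ∃ c : κ → ℝ, ∑ k, c k • (W.mkQ ∘ v) (a k) = W.mkQ (v i) := by
    intro i
    have : W.mkQ (v i) ∈ Submodule.span ℝ (Set.range ((W.mkQ ∘ v) ∘ a)) := by
      rw [htop]; trivial
    exact (Submodule.mem_span_range_iff_exists_fun ℝ).1 this
  choose c hc using hex
  refine ⟨Kᶜ, fun i l => if i ∈ Kᶜ ∧ l ∉ Kᶜ then - ∑ k, if a k = l then c i k else 0 else 0,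
    ?_, fun i l h => if_neg h, ?_⟩
  · have h1 := Finset.card_add_card_compl K
    have h2 := W.finrank_quotient_add_finrank
    rw [Module.finrank_eq_card_basis v] at h2
    omega
  · intro i hi
    rw [← Submodule.Quotient.mk_eq_zero, ← Submodule.mkQ_apply, map_add, ← hc i, map_sum,
      ← Finset.sum_subset (Finset.subset_univ K), hK, Finset.sum_image ha.injOn,
      ← Finset.sum_add_distrib]
    · refine Finset.sum_eq_zero fun k _ => ?_
      have hk : a k ∉ (Finset.univ.image a)ᶜ := by simp
      beta_reduce
      rw [← hK] at hk ⊢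
      rw [if_pos ⟨hi, hk⟩]
      rw [Finset.sum_eq_single k (fun k' _ hk' => if_neg (ha.ne hk')) (by simp), if_pos rfl,
        neg_smul, map_neg, map_smul]
      exact add_neg_cancel _
    · intro l _ hl
      beta_reduce
      rw [if_neg (by simpa using fun _ => hl), zero_smul, map_zero]

theorem LinearIndependent.finrank_span_image {V ι : Type*} [AddCommGroup V] [Module ℝ V]
    {e : ι → V} (he : LinearIndependent ℝ e) (I : Finset ι) :
    Module.finrank ℝ (Submodule.span ℝ (e '' I)) = I.card := by
  have h := finrank_span_eq_card (he.comp _ (Subtype.val_injective (p := (· ∈ I))))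
  rw [Fintype.card_coe] at h
  rw [← h, Set.range_comp, Subtype.range_coe_subtype]
  rfl

/-- A tuple of tensors is stable if no pair of families of linearly independent vectors spanning
too large subspaces is orthogonal to all of its members. -/
def IsStableTuple {V U : Type*}
    [NormedAddCommGroup V] [InnerProductSpace ℝ V]
    [NormedAddCommGroup U] [InnerProductSpace ℝ U] {ν : Type*} (y : ν → V ⊗[ℝ] U) : Prop :=
  ∀ (e : Fin (Module.finrank ℝ V) → V) (f : Fin (Module.finrank ℝ U) → U),
    LinearIndependent ℝ e → LinearIndependent ℝ f →
      StrictHall fun i j => ∃ k, inner ℝ (y k) (e i ⊗ₜ[ℝ] f j) ≠ 0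

/-! ### Charts for unstable tuples and their dimension -/

section Chart

variable {ι κ : Type*} [Fintype ι] [Fintype κ] [DecidableEq ι] [DecidableEq κ] (m : ℕ)

/-- Parameters for the tuples annihilated by a pair of subspaces in the chart `(I, J)`: the two
echelon matrices, the free coordinates of the differences, and the base point. -/
abbrev ChartDomain (I : Finset ι) (J : Finset κ) : Type _ :=
  ({x : ι × ι // x.1 ∈ I ∧ x.2 ∉ I} → ℝ) × ({x : κ × κ // x.1 ∈ J ∧ x.2 ∉ J} → ℝ) ×
    (Fin m × {x : ι × κ // ¬ (x.1 ∈ I ∧ x.2 ∈ J)} → ℝ) × (ι × κ → ℝ)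

/-- Extension of an echelon matrix by zero. -/
def extendEchelon {ι : Type*} [DecidableEq ι] (I : Finset ι)
    (d : {x : ι × ι // x.1 ∈ I ∧ x.2 ∉ I} → ℝ) (i l : ι) : ℝ :=
  if h : i ∈ I ∧ l ∉ I then d ⟨(i, l), h⟩ else 0

/-- Extension of the free coordinates by zero. -/
def extendFree {m : ℕ} (I : Finset ι) (J : Finset κ)
    (w : Fin m × {x : ι × κ // ¬ (x.1 ∈ I ∧ x.2 ∈ J)} → ℝ) (k : Fin m) (i : ι) (j : κ) : ℝ :=
  if h : ¬ (i ∈ I ∧ j ∈ J) then w (k, ⟨(i, j), h⟩) else 0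

/-- Coordinates of the difference with index `k`, the dependent block being solved for. -/
def chartDiff {m : ℕ} (I : Finset ι) (J : Finset κ) (z : ChartDomain m I J) (k : Fin m)
    (x : ι × κ) : ℝ :=
  if x.1 ∈ I ∧ x.2 ∈ J then
    -(∑ l, extendEchelon I z.1 x.1 l * extendFree I J z.2.2.1 k l x.2 +
      ∑ r, extendEchelon J z.2.1 x.2 r * extendFree I J z.2.2.1 k x.1 r +
      ∑ l, ∑ r, extendEchelon I z.1 x.1 l * extendEchelon J z.2.1 x.2 r *
        extendFree I J z.2.2.1 k l r)
  else extendFree I J z.2.2.1 k x.1 x.2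

/-- The parametrization of annihilated tuples in the chart `(I, J)`. -/
def chartMap (I : Finset ι) (J : Finset κ) (z : ChartDomain m I J) :
    Fin (m + 1) → ι × κ → ℝ :=
  Fin.cons z.2.2.2 fun k x => z.2.2.2 x + chartDiff I J z k x

theorem contDiff_chartMap (I : Finset ι) (J : Finset κ) :
    ContDiff ℝ 1 (chartMap m I J) := by
  have h1 : ∀ i l, ContDiff ℝ 1 fun z : ChartDomain m I J => extendEchelon I z.1 i l := by
    intro i l
    unfold extendEchelon
    split_ifs <;> fun_prop
  have h2 : ∀ i l, ContDiff ℝ 1 fun z : ChartDomain m I J => extendEchelon J z.2.1 i l := by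
    intro i l
    unfold extendEchelon
    split_ifs <;> fun_prop
  have h3 : ∀ k i j, ContDiff ℝ 1 fun z : ChartDomain m I J =>
      extendFree I J z.2.2.1 k i j := by
    intro k i j
    unfold extendFree
    split_ifs <;> fun_prop
  refine contDiff_pi.2 fun k => contDiff_pi.2 fun x => ?_
  refine Fin.cases ?_ (fun k => ?_) k
  · simp only [chartMap, Fin.cons_zero]
    fun_prop
  · simp only [chartMap, Fin.cons_succ, chartDiff]
    split_ifs <;> fun_prop

theorem card_echelonIndex {ι : Type*} [Fintype ι] [DecidableEq ι] (I : Finset ι) :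
    Fintype.card {x : ι × ι // x.1 ∈ I ∧ x.2 ∉ I} = I.card * Iᶜ.card := by
  rw [← Finset.card_product]
  refine Fintype.card_of_subtype _ fun x => ?_
  simp

theorem finrank_chartDomain (I : Finset ι) (J : Finset κ) :
    Module.finrank ℝ (ChartDomain m I J) =
      I.card * Iᶜ.card + (J.card * Jᶜ.card +
        (m * (Fintype.card ι * Fintype.card κ - I.card * J.card) +
          Fintype.card ι * Fintype.card κ)) := by
  have h2 : Fintype.card {x : ι × κ // ¬ (x.1 ∈ I ∧ x.2 ∈ J)} =
      Fintype.card ι * Fintype.card κ - I.card * J.card := by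
    rw [Fintype.card_subtype_compl, Fintype.card_prod, ← Finset.card_product]
    congr 1
    refine Fintype.card_of_subtype _ fun x => ?_
    simp
  rw [Module.finrank_prod, Module.finrank_prod, Module.finrank_prod,
    Module.finrank_fintype_fun_eq_card,
    Module.finrank_fintype_fun_eq_card, Module.finrank_fintype_fun_eq_card,
    Module.finrank_fintype_fun_eq_card,
    card_echelonIndex, card_echelonIndex, Fintype.card_prod, h2, Fintype.card_prod,
    Fintype.card_fin]

end Chart

/-- Choosing the two subspaces costs tt' + rr' parameters, while annihilation imposes mtr equations.
From t/p + r/q ≥ 1 follow t'/p ≤ r/q and r'/q ≤ t/p, so the cost is at most (p/q + q/p) tr < mtr. -/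
theorem chart_dimension_lt {p q m t t' r r' : ℕ} (hp : t + t' = p) (hq : r + r' = q)
    (ht : 0 < t) (hr : 0 < r) (h : p * q ≤ t * q + r * p) (hm : p ^ 2 + q ^ 2 < m * (p * q)) :
    t * t' + (r * r' + (m * (p * q - t * r) + p * q)) < (m + 1) * (p * q) := by
  have htr : t * r ≤ p * q := Nat.mul_le_mul (by omega) (by omega)
  obtain ⟨s, hs⟩ := Nat.exists_eq_add_of_le htr
  rw [hs, Nat.add_sub_cancel_left, ← hs]
  have h0 : 0 < p * q := Nat.mul_pos (by omega) (by omega)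
  have h1 : q * t' ≤ r * p := by subst hp; nlinarith
  have h2 : p * r' ≤ t * q := by subst hq; nlinarith
  have h3 : p * q * (t * t') ≤ p ^ 2 * (t * r) := by
    calc p * q * (t * t') = p * t * (q * t') := by ring
      _ ≤ p * t * (r * p) := Nat.mul_le_mul_left _ h1
      _ = _ := by ring
  have h4 : p * q * (r * r') ≤ q ^ 2 * (t * r) := by
    calc p * q * (r * r') = q * r * (p * r') := by ring
      _ ≤ q * r * (t * q) := Nat.mul_le_mul_left _ h2
      _ = _ := by ring
  have h5 : (p ^ 2 + q ^ 2) * (t * r) < m * (p * q) * (t * r) :=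
    Nat.mul_lt_mul_of_pos_right hm (Nat.mul_pos ht hr)
  have h6 : p * q * (t * t' + r * r') < p * q * (m * (t * r)) := by
    calc _ ≤ (p ^ 2 + q ^ 2) * (t * r) := by nlinarith
      _ < _ := h5
      _ = _ := by ring
  have h7 := Nat.lt_of_mul_lt_mul_left h6
  have h8 : (m + 1) * (p * q) = m * (t * r) + m * s + p * q := by rw [add_mul, hs]; ring
  rw [h8]
  omega


/-! ### Generic samples are stable -/

section Generic

variable {V U : Type*}
  [NormedAddCommGroup V] [InnerProductSpace ℝ V]
  [NormedAddCommGroup U] [InnerProductSpace ℝ U]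

theorem inner_tmul_smul (y : V ⊗[ℝ] U) (a : V) (r : ℝ) (b : U) :
    inner ℝ y (a ⊗ₜ[ℝ] (r • b)) = r * inner ℝ y (a ⊗ₜ[ℝ] b) := by
  rw [TensorProduct.tmul_smul]
  exact real_inner_smul_right (F := V ⊗[ℝ] U) _ _ _

theorem inner_smul_tmul (y : V ⊗[ℝ] U) (r : ℝ) (a : V) (b : U) :
    inner ℝ y ((r • a) ⊗ₜ[ℝ] b) = r * inner ℝ y (a ⊗ₜ[ℝ] b) := by
  rw [← TensorProduct.smul_tmul']
  exact real_inner_smul_right (F := V ⊗[ℝ] U) _ _ _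

theorem inner_tmul_eq_zero_of_mem_span {y : V ⊗[ℝ] U} {s : Set V} {t : Set U}
    (h : ∀ a ∈ s, ∀ b ∈ t, inner ℝ y (a ⊗ₜ[ℝ] b) = 0) {a : V} {b : U}
    (ha : a ∈ Submodule.span ℝ s) (hb : b ∈ Submodule.span ℝ t) :
    inner ℝ y (a ⊗ₜ[ℝ] b) = 0 := by
  induction ha using Submodule.span_induction with
  | mem a ha =>
    induction hb using Submodule.span_induction with
    | mem b hb => exact h a ha b hb
    | zero => simp
    | add b c _ _ hb hc => rw [TensorProduct.tmul_add, inner_add_right, hb, hc, add_zero]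
    | smul r b _ hb => rw [inner_tmul_smul, hb, mul_zero]
  | zero => simp
  | add a c _ _ ha hc => rw [TensorProduct.add_tmul, inner_add_right, ha, hc, add_zero]
  | smul r a _ ha => rw [inner_smul_tmul, ha, mul_zero]

variable {ι κ : Type*} [Fintype ι] [Fintype κ] [DecidableEq ι] [DecidableEq κ]

/-- Expanding the orthogonality relation for the cell (i, j) solves for the coordinate of y along
v_i ⊗ u_j. The echelon shape ensures that only coordinates outside I × J occur on the other side, so
the chart recovers every annihilated tuple. -/
theorem chartDiff_eq_inner {m : ℕ} (v : ι → V) (u : κ → U) (I : Finset ι) (J : Finset κ)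
    (d : ι → ι → ℝ) (c : κ → κ → ℝ) (hd : ∀ i l, ¬ (i ∈ I ∧ l ∉ I) → d i l = 0)
    (hc : ∀ i l, ¬ (i ∈ J ∧ l ∉ J) → c i l = 0) (y : Fin m → V ⊗[ℝ] U) (x₀ : ι × κ → ℝ)
    (h : ∀ k, ∀ i ∈ I, ∀ j ∈ J,
      inner ℝ (y k) ((v i + ∑ l, d i l • v l) ⊗ₜ[ℝ] (u j + ∑ r, c j r • u r)) = 0)
    (k : Fin m) (x : ι × κ) :
    chartDiff I J (fun z => d z.1.1 z.1.2, fun z => c z.1.1 z.1.2,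
      fun z => inner ℝ (y z.1) (v z.2.1.1 ⊗ₜ[ℝ] u z.2.1.2), x₀) k x =
        inner ℝ (y k) (v x.1 ⊗ₜ[ℝ] u x.2) := by
  have hd' : ∀ i l, extendEchelon I (fun z => d z.1.1 z.1.2) i l = d i l := by
    intro i l
    unfold extendEchelon
    split_ifs with hil
    · rfl
    · exact (hd i l hil).symm
  have hc' : ∀ i l, extendEchelon J (fun z => c z.1.1 z.1.2) i l = c i l := by
    intro i l
    unfold extendEchelon
    split_ifs with hil
    · rfl
    · exact (hc i l hil).symm
  have hf : ∀ i j, ¬ (i ∈ I ∧ j ∈ J) → extendFree I J (fun z : Fin m × {x : ι × κ //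
      ¬ (x.1 ∈ I ∧ x.2 ∈ J)} => inner ℝ (y z.1) (v z.2.1.1 ⊗ₜ[ℝ] u z.2.1.2)) k i j =
        inner ℝ (y k) (v i ⊗ₜ[ℝ] u j) := by
    intro i j hij
    exact dif_pos hij
  obtain ⟨i, j⟩ := x
  unfold chartDiff
  simp only [hd', hc']
  split_ifs with hij
  · have h0 := h k i hij.1 j hij.2
    rw [TensorProduct.add_tmul, TensorProduct.tmul_add, TensorProduct.tmul_add,
      TensorProduct.sum_tmul, TensorProduct.sum_tmul, TensorProduct.tmul_sum] at h0
    simp only [TensorProduct.tmul_sum, inner_add_right, inner_sum, inner_tmul_smul,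
      inner_smul_tmul] at h0
    have e1 : ∀ l, d i l * extendFree I J (fun z : Fin m × {x : ι × κ //
        ¬ (x.1 ∈ I ∧ x.2 ∈ J)} => inner ℝ (y z.1) (v z.2.1.1 ⊗ₜ[ℝ] u z.2.1.2)) k l j =
          d i l * inner ℝ (y k) (v l ⊗ₜ[ℝ] u j) := by
      intro l
      by_cases hl : l ∈ I
      · rw [hd i l (by tauto), zero_mul, zero_mul]
      · rw [hf l j (by tauto)]
    have e2 : ∀ r, c j r * extendFree I J (fun z : Fin m × {x : ι × κ //
        ¬ (x.1 ∈ I ∧ x.2 ∈ J)} => inner ℝ (y z.1) (v z.2.1.1 ⊗ₜ[ℝ] u z.2.1.2)) k i r =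
          c j r * inner ℝ (y k) (v i ⊗ₜ[ℝ] u r) := by
      intro r
      by_cases hr : r ∈ J
      · rw [hc j r (by tauto), zero_mul, zero_mul]
      · rw [hf i r (by tauto)]
    have e3 : ∀ l r, d i l * c j r * extendFree I J (fun z : Fin m × {x : ι × κ //
        ¬ (x.1 ∈ I ∧ x.2 ∈ J)} => inner ℝ (y z.1) (v z.2.1.1 ⊗ₜ[ℝ] u z.2.1.2)) k l r =
          c j r * (d i l * inner ℝ (y k) (v l ⊗ₜ[ℝ] u r)) := by
      intro l r
      by_cases hl : l ∈ I
      · rw [hd i l (by tauto)]; ring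
      · rw [hf l r (by tauto)]; ring
    simp only [e1, e2, e3]
    linarith
  · exact hf i j hij

variable [FiniteDimensional ℝ V] [FiniteDimensional ℝ U]
  [MeasurableSpace (V ⊗[ℝ] U)] [BorelSpace (V ⊗[ℝ] U)]

/-- The differences of a generic tuple of tensors are stable. -/
theorem ae_isStableTuple {m : ℕ}
    (hm : Module.finrank ℝ V ^ 2 + Module.finrank ℝ U ^ 2 <
      m * (Module.finrank ℝ V * Module.finrank ℝ U)) :
    ∀ᵐ x ∂(volume : Measure (Fin (m + 1) → V ⊗[ℝ] U)),
      IsStableTuple fun k : Fin m => x k.succ - x 0 := by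
  set p := Module.finrank ℝ V with hp
  set q := Module.finrank ℝ U with hq
  let v : OrthonormalBasis (Fin p) ℝ V := stdOrthonormalBasis ℝ V
  let u : OrthonormalBasis (Fin q) ℝ U := stdOrthonormalBasis ℝ U
  let B : OrthonormalBasis (Fin p × Fin q) ℝ (V ⊗[ℝ] U) := v.tensorProduct u
  let Ψ : (Fin (m + 1) → Fin p × Fin q → ℝ) → Fin (m + 1) → V ⊗[ℝ] U :=
    fun c k => ∑ x, c k x • B x
  have hΨ : ContDiff ℝ 1 Ψ := by fun_prop
  have hnull : volume (⋃ (I : Finset (Fin p)) (J : Finset (Fin q))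
      (_ : I.Nonempty ∧ J.Nonempty ∧ p * q ≤ I.card * q + J.card * p),
        Set.range (Ψ ∘ chartMap m I J)) = 0 := by
    refine measure_iUnion_null fun I => measure_iUnion_null fun J => measure_iUnion_null ?_
    rintro ⟨hI, hJ, hIJ⟩
    refine ContDiff.addHaar_range_eq_zero volume (hΨ.comp (contDiff_chartMap m I J)) ?_
    have hF : Module.finrank ℝ (Fin (m + 1) → V ⊗[ℝ] U) = (m + 1) * (p * q) := by
      rw [Module.finrank_pi_fintype, Finset.sum_const, Finset.card_univ, Fintype.card_fin,
        Module.finrank_tensorProduct, smul_eq_mul]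
    rw [hF, finrank_chartDomain, Fintype.card_fin, Fintype.card_fin]
    refine chart_dimension_lt ?_ ?_ hI.card_pos hJ.card_pos hIJ hm
    · rw [Finset.card_add_card_compl, Fintype.card_fin]
    · rw [Finset.card_add_card_compl, Fintype.card_fin]
  refine measure_mono_null ?_ hnull
  intro x hx
  simp only [IsStableTuple, StrictHall, Set.mem_compl_iff, Set.mem_ofPred_eq] at hx
  push Not at hx
  obtain ⟨e, f, he, hf, I₀, J₀, hI₀, hJ₀, h0, hcard⟩ := hx
  -- Only the spans matter, so the frames are traded for echelon families. The new index sets may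
  -- differ from `I₀`, `J₀` but have the same sizes, so the failed Hall inequality persists.
  obtain ⟨I, d, hI, hd, hId⟩ := Submodule.exists_echelon v.toBasis (Submodule.span ℝ (e '' I₀))
  obtain ⟨J, c, hJ, hc, hJc⟩ := Submodule.exists_echelon u.toBasis (Submodule.span ℝ (f '' J₀))
  have hI' : I.card = I₀.card := by
    rw [hI, he.finrank_span_image]
  have hJ' : J.card = J₀.card := by
    rw [hJ, hf.finrank_span_image]
  simp only [Fintype.card_fin] at hcard
  refine Set.mem_iUnion₂.2 ⟨I, J, Set.mem_iUnion.2 ⟨⟨?_, ?_, ?_⟩, ?_⟩⟩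
  · rw [← Finset.card_pos, hI']; exact hI₀.card_pos
  · rw [← Finset.card_pos, hJ']; exact hJ₀.card_pos
  · rw [hI', hJ']; exact hcard
  · have key := chartDiff_eq_inner v u I J d c hd hc (fun k => x k.succ - x 0)
      (fun z => inner ℝ (x 0) (v z.1 ⊗ₜ[ℝ] u z.2)) (by
        intro k i hi j hj
        refine inner_tmul_eq_zero_of_mem_span ?_ (hId i hi) (hJc j hj)
        rintro _ ⟨i', hi', rfl⟩ _ ⟨j', hj', rfl⟩
        exact h0 i' hi' j' hj' k)
    let z₀ : ChartDomain m I J := (fun z => d z.1.1 z.1.2, fun z => c z.1.1 z.1.2,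
      fun z => inner ℝ (x z.1.succ - x 0) (v z.2.1.1 ⊗ₜ[ℝ] u z.2.1.2),
      fun z => inner ℝ (x 0) (v z.1 ⊗ₜ[ℝ] u z.2))
    refine ⟨z₀, funext fun k => ?_⟩
    have hk : chartMap m I J z₀ k = fun z => inner ℝ (B z) (x k) := by
      funext z
      refine Fin.cases ?_ (fun k => ?_) k
      · simp only [chartMap, Fin.cons_zero, B, OrthonormalBasis.tensorProduct_apply', z₀]
        exact real_inner_comm (F := V ⊗[ℝ] U) _ _
      · simp only [chartMap, Fin.cons_succ, B, OrthonormalBasis.tensorProduct_apply', key, z₀]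
        rw [inner_sub_left, real_inner_comm (x k.succ)]
        ring
    change ∑ z, chartMap m I J z₀ k z • B z = x k
    rw [hk]
    exact B.sum_repr' (x k)

end Generic

theorem StrictHall.mono {ι κ : Type*} [Fintype ι] [Fintype κ] {R R' : ι → κ → Prop}
    (h : StrictHall R) (hR : ∀ i j, R i j → R' i j) : StrictHall R' :=
  fun I J hI hJ hIJ => h I J hI hJ fun i hi j hj hij => hIJ i hi j hj (hR i j hij)

/-! ### Operators diagonal in a frame -/

section DiagOp

variable {E ι : Type*} [NormedAddCommGroup E] [InnerProductSpace ℝ E] [Fintype ι]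

/-- The self-adjoint operator `∑ aᵢ eᵢ eᵢᵀ`. -/
def diagOp (e : ι → E) (a : ι → ℝ) : E →L[ℝ] E :=
  ∑ i, a i • (innerSL ℝ (e i)).smulRight (e i)

theorem diagOp_apply (e : ι → E) (a : ι → ℝ) (x : E) :
    diagOp e a x = ∑ i, (a i * inner ℝ (e i) x) • e i := by
  simp [diagOp, smul_smul]

theorem inner_diagOp (e : ι → E) (a : ι → ℝ) (x y : E) :
    inner ℝ (diagOp e a x) y = ∑ i, a i * (inner ℝ (e i) x * inner ℝ (e i) y) := by
  rw [diagOp_apply, sum_inner]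
  refine Finset.sum_congr rfl fun i _ => ?_
  rw [real_inner_smul_left, mul_assoc]

theorem inner_diagOp_self (e : ι → E) (a : ι → ℝ) (x : E) :
    inner ℝ (diagOp e a x) x = ∑ i, a i * inner ℝ (e i) x ^ 2 := by
  rw [inner_diagOp]
  simp only [sq]

theorem isSymmetric_diagOp (e : ι → E) (a : ι → ℝ) :
    (diagOp e a : E →ₗ[ℝ] E).IsSymmetric := by
  intro x y
  rw [ContinuousLinearMap.coe_coe, inner_diagOp, real_inner_comm, inner_diagOp]
  simp only [mul_comm]

theorem diagOp_mem_posDefOperators {e : ι → E} (he : ⊤ ≤ Submodule.span ℝ (Set.range e))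
    {a : ι → ℝ} (ha : ∀ i, 0 < a i) : diagOp e a ∈ posDefOperators E := by
  refine ⟨isSymmetric_diagOp e a, fun v hv => ?_⟩
  rw [inner_diagOp_self]
  refine lt_of_le_of_ne (Finset.sum_nonneg fun i _ => mul_nonneg (ha i).le (sq_nonneg _)) ?_
  intro h0
  apply hv
  have h1 := (Finset.sum_eq_zero_iff_of_nonneg fun i _ =>
    mul_nonneg (ha i).le (sq_nonneg (inner ℝ (e i) v))).1 h0.symm
  have h2 : ∀ x ∈ Submodule.span ℝ (Set.range e), inner ℝ x v = 0 := by
    intro x hx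
    induction hx using Submodule.span_induction with
    | mem x hx =>
      obtain ⟨i, rfl⟩ := hx
      simpa [(ha i).ne'] using h1 i (Finset.mem_univ i)
    | zero => simp
    | add x y _ _ hx hy => rw [inner_add_left, hx, hy, add_zero]
    | smul r x _ hx => rw [real_inner_smul_left, hx, mul_zero]
  exact inner_self_eq_zero.1 (h2 v (he trivial))

/-- In the basis `b` the matrix is diag(a) times the Gram matrix. The Gram factor does not involve
`a`, so it cancels when likelihoods in one basis are compared. -/
theorem det_diagOp [DecidableEq ι] (b : Module.Basis ι ℝ E) (a : ι → ℝ) :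
    (diagOp b a).det = (∏ i, a i) * (Matrix.of fun i j => inner ℝ (b i) (b j)).det := by
  rw [ContinuousLinearMap.det, ← LinearMap.det_toMatrix b]
  have : LinearMap.toMatrix b b (diagOp b a) =
      Matrix.diagonal a * Matrix.of fun i j => inner ℝ (b i) (b j) := by
    ext i j
    rw [LinearMap.toMatrix_apply, ContinuousLinearMap.coe_coe, diagOp_apply,
      Module.Basis.repr_sum_self, Matrix.diagonal_mul, Matrix.of_apply]
  rw [this, Matrix.det_mul, Matrix.det_diagonal]

theorem det_ne_zero_of_mem_posDefOperators [FiniteDimensional ℝ E] {T : E →L[ℝ] E}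
    (hT : T ∈ posDefOperators E) : T.det ≠ 0 := by
  intro h
  obtain ⟨x, hx, hx0⟩ := SetLike.exists_of_lt (LinearMap.bot_lt_ker_of_det_eq_zero h)
  rw [LinearMap.mem_ker, ContinuousLinearMap.coe_coe] at hx
  have := hT.2 x (by simpa using hx0)
  rw [hx, inner_zero_left] at this
  exact lt_irrefl _ this

theorem diagOp_one_orthonormalBasis (v : OrthonormalBasis ι ℝ E) : diagOp v 1 = 1 := by
  ext x
  rw [diagOp_apply]
  simpa using v.sum_repr' x

theorem exists_eq_diagOp [FiniteDimensional ℝ E] {P : E →L[ℝ] E} (hP : P ∈ posDefOperators E) :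
    ∃ (v : OrthonormalBasis (Fin (Module.finrank ℝ E)) ℝ E)
      (a : Fin (Module.finrank ℝ E) → ℝ), (∀ i, 0 < a i) ∧ P = diagOp v a := by
  let v := hP.1.eigenvectorBasis rfl
  let a := hP.1.eigenvalues rfl
  have hva : ∀ i, P (v i) = a i • v i := fun i => hP.1.apply_eigenvectorBasis rfl i
  refine ⟨v, a, fun i => ?_, ?_⟩
  · have := hP.2 (v i) (v.orthonormal.ne_zero i)
    rw [hva, real_inner_smul_left, real_inner_self_eq_norm_sq, v.norm_eq_one] at this
    simpa using this
  · ext x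
    rw [diagOp_apply]
    conv_lhs => rw [← v.sum_repr' x, map_sum]
    refine Finset.sum_congr rfl fun i _ => ?_
    rw [map_smul, hva, smul_smul, mul_comm]

theorem diagOp_mul_diagOp_mul_diagOp {R : E →L[ℝ] E} (hR : (R : E →ₗ[ℝ] E).IsSymmetric)
    (w : ι → E) (a : ι → ℝ) : R * diagOp w a * R = diagOp (fun i => R (w i)) a := by
  ext x
  simp only [mul_apply_eq_comp, diagOp_apply, map_sum, map_smul]
  refine Finset.sum_congr rfl fun i _ => ?_
  rw [← hR.apply_clm]

/-- Two positive definite operators can be diagonalized simultaneously by congruence. -/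
theorem exists_simultaneous_diagOp [FiniteDimensional ℝ E] {P Q : E →L[ℝ] E}
    (hP : P ∈ posDefOperators E) (hQ : Q ∈ posDefOperators E) :
    ∃ (e : Module.Basis (Fin (Module.finrank ℝ E)) ℝ E)
      (a : Fin (Module.finrank ℝ E) → ℝ), (∀ i, 0 < a i) ∧ P = diagOp e 1 ∧ Q = diagOp e a := by
  obtain ⟨v, l, hl, rfl⟩ := exists_eq_diagOp hP
  have hmul : ∀ c d : Fin (Module.finrank ℝ E) → ℝ,
      diagOp v c * diagOp v d = diagOp v (c * d) := by
    intro c d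
    ext x
    rw [mul_apply_eq_comp, diagOp_apply v d, map_sum, diagOp_apply]
    refine Finset.sum_congr rfl fun i _ => ?_
    rw [map_smul, diagOp_apply, Finset.sum_eq_single i, v.inner_eq_one, smul_smul]
    · simp only [Pi.mul_apply]; congr 1; ring
    · intro j _ hj
      rw [v.inner_eq_zero hj, mul_zero, zero_smul]
    · simp
  -- R is the square root of P and R' its inverse. An orthonormal eigenbasis of R'QR', pushed
  -- forward by R, diagonalizes both P and Q.
  set R := diagOp v fun i => Real.sqrt (l i) with hR
  set R' := diagOp v fun i => (Real.sqrt (l i))⁻¹ with hR'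
  have hRs := isSymmetric_diagOp v fun i => Real.sqrt (l i)
  have hRs' := isSymmetric_diagOp v fun i => (Real.sqrt (l i))⁻¹
  have hs : ∀ i, Real.sqrt (l i) ≠ 0 := fun i => (Real.sqrt_pos.2 (hl i)).ne'
  have hRR' : R * R' = 1 := by
    rw [hmul, ← diagOp_one_orthonormalBasis v]
    congr 1
    ext i
    simp [hs i]
  have hR'R : R' * R = 1 := by
    rw [hmul, ← diagOp_one_orthonormalBasis v]
    congr 1
    ext i
    simp [hs i]
  have hRR : R * R = diagOp v l := by
    rw [hmul]
    congr 1
    ext i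
    simp [Real.mul_self_sqrt (hl i).le]
  have hS : R' * Q * R' ∈ posDefOperators E := by
    constructor
    · intro x y
      simp only [ContinuousLinearMap.coe_coe, mul_apply_eq_comp]
      rw [hRs'.apply_clm, hQ.1.apply_clm, hRs'.apply_clm]
    · intro x hx
      simp only [mul_apply_eq_comp]
      rw [hRs'.apply_clm]
      refine hQ.2 _ fun h0 => hx ?_
      rw [← one_apply_eq_self (F := E →L[ℝ] E) x, ← hRR', mul_apply_eq_comp, h0,
        map_zero]
  obtain ⟨w, a, ha, hw⟩ := exists_eq_diagOp hS
  let Re : E ≃ₗ[ℝ] E := LinearEquiv.ofLinearMap (R : E →ₗ[ℝ] E) (R' : E →ₗ[ℝ] E)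
    (by ext x; exact congrArg (fun T : E →L[ℝ] E => T x) hRR')
    (by ext x; exact congrArg (fun T : E →L[ℝ] E => T x) hR'R)
  have he : ⇑(w.toBasis.map Re) = fun i => R (w i) := by
    ext i
    simp [Re]
  refine ⟨w.toBasis.map Re, a, ha, ?_, ?_⟩
  · rw [he, ← diagOp_mul_diagOp_mul_diagOp hRs, diagOp_one_orthonormalBasis, mul_one, hRR]
  · rw [he, ← diagOp_mul_diagOp_mul_diagOp hRs, ← hw]
    calc Q = (R * R') * Q * (R' * R) := by rw [hRR', hR'R, one_mul, mul_one]
      _ = R * (R' * Q * R') * R := by simp only [mul_assoc]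

end DiagOp

/-! ### Kronecker products and compactness of frames -/

section TensorDiag

variable {V U ι κ : Type*} [NormedAddCommGroup V] [InnerProductSpace ℝ V]
  [NormedAddCommGroup U] [InnerProductSpace ℝ U] [Fintype ι] [Fintype κ]

theorem mapL_diagOp (e : ι → V) (f : κ → U) (a : ι → ℝ) (b : κ → ℝ) :
    TensorProduct.mapL (diagOp e a) (diagOp f b) =
      diagOp (fun x : ι × κ => e x.1 ⊗ₜ[ℝ] f x.2) fun x => a x.1 * b x.2 := by
  have h : ∀ (x : V) (y : U), TensorProduct.mapL (diagOp e a) (diagOp f b) (x ⊗ₜ[ℝ] y) =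
      diagOp (fun x : ι × κ => e x.1 ⊗ₜ[ℝ] f x.2) (fun x => a x.1 * b x.2) (x ⊗ₜ[ℝ] y) := by
    intro x y
    rw [TensorProduct.mapL_tmul, diagOp_apply, diagOp_apply, diagOp_apply, Fintype.sum_prod_type,
      TensorProduct.sum_tmul]
    refine Finset.sum_congr rfl fun i _ => ?_
    rw [TensorProduct.tmul_sum]
    refine Finset.sum_congr rfl fun j _ => ?_
    rw [TensorProduct.inner_tmul, TensorProduct.smul_tmul_smul]
    congr 1
    ring
  apply ContinuousLinearMap.coe_injective
  exact TensorProduct.ext' h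

end TensorDiag

theorem continuous_inner_const {E : Type*} [NormedAddCommGroup E] [InnerProductSpace ℝ E] (y : E) :
    Continuous fun t : E => inner ℝ t y := by
  fun_prop

section Frames

variable {E ι : Type*} [NormedAddCommGroup E] [InnerProductSpace ℝ E] [Fintype ι]

theorem isCompact_setOf_orthonormal [FiniteDimensional ℝ E] :
    IsCompact {e : ι → E | Orthonormal ℝ e} := by
  classical
  refine Metric.isCompact_of_isClosed_isBounded ?_ ?_
  · simp only [orthonormal_iff_ite, Set.ofPred_forall]
    refine isClosed_iInter fun i => isClosed_iInter fun j => isClosed_eq ?_ continuous_const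
    fun_prop
  · refine Metric.isBounded_closedBall (x := (0 : ι → E)) (r := 1) |>.subset fun e he => ?_
    rw [mem_closedBall_zero_iff, pi_norm_le_iff_of_nonneg zero_le_one]
    exact fun i => (he.norm_eq_one i).le

theorem continuous_diagOp :
    Continuous fun z : (ι → E) × (ι → ℝ) => diagOp z.1 z.2 := by
  unfold diagOp
  refine continuous_finsetSum _ fun i _ => ?_
  refine Continuous.smul ((continuous_apply i).comp continuous_snd) ?_
  have h : Continuous fun e : ι → E =>
      ContinuousLinearMap.smulRightL ℝ E E (innerSL ℝ (e i)) (e i) :=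
    (ContinuousLinearMap.smulRightL ℝ E E).continuous₂.comp
      (((innerSL ℝ).continuous.comp (continuous_apply i)).prodMk (continuous_apply i))
  exact h.comp continuous_fst

end Frames

/-! ### Profiling out the mean -/

section Mean

variable {E : Type*} [NormedAddCommGroup E] [InnerProductSpace ℝ E] {n : ℕ}

/-- The sample mean. -/
def sampleMean (x : Fin n → E) : E := (1 / (n : ℝ)) • ∑ i, x i

/-- Deviations from the sample mean sum to zero, which kills the cross terms. -/
theorem sum_inner_sub_eq (hn : n ≠ 0) {T : E →L[ℝ] E} (hT : (T : E →ₗ[ℝ] E).IsSymmetric)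
    (x : Fin n → E) (M : E) :
    (1 / (n : ℝ)) * ∑ i, inner ℝ (T (x i - M)) (x i - M) =
      (1 / (n : ℝ)) * ∑ i, inner ℝ (T (x i - sampleMean x)) (x i - sampleMean x) +
        inner ℝ (T (sampleMean x - M)) (sampleMean x - M) := by
  set w := sampleMean x - M with hw
  have hn' : (n : ℝ) ≠ 0 := by exact_mod_cast hn
  have h0 : ∑ i, (x i - sampleMean x) = 0 := by
    rw [Finset.sum_sub_distrib, Finset.sum_const, Finset.card_univ, Fintype.card_fin, sampleMean,
      ← Nat.cast_smul_eq_nsmul ℝ, smul_smul, mul_one_div_cancel hn', one_smul, sub_self]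
  have h1 : ∀ i, inner ℝ (T (x i - M)) (x i - M) =
      inner ℝ (T (x i - sampleMean x)) (x i - sampleMean x) +
        2 * inner ℝ (T w) (x i - sampleMean x) + inner ℝ (T w) w := by
    intro i
    have : x i - M = (x i - sampleMean x) + w := by rw [hw]; abel
    rw [this, map_add, inner_add_left, inner_add_right, inner_add_right,
      hT.apply_clm (x i - sampleMean x) w, real_inner_comm (T w) (x i - sampleMean x)]
    ring
  simp only [h1, Finset.sum_add_distrib, ← Finset.mul_sum, ← inner_sum]
  rw [h0, inner_zero_right, Finset.sum_const, Finset.card_univ, Fintype.card_fin, ← Nat.cast_smul_eq_nsmul ℝ,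
    real_inner_smul_right]
  field_simp
  ring

end Mean

/-! ### The likelihood in coordinates -/

section Likelihood

variable {V U : Type*}
  [NormedAddCommGroup V] [InnerProductSpace ℝ V]
  [NormedAddCommGroup U] [InnerProductSpace ℝ U] {n : ℕ}

theorem continuous_tmul_apply {ι κ : Type*} (i : ι) (j : κ) :
    Continuous fun z : (ι → V) × (κ → U) => z.1 i ⊗ₜ[ℝ] z.2 j := by
  have h : Continuous fun z : (ι → V) × (κ → U) => (z.1 i, z.2 j) := by fun_prop
  have h' : Continuous fun x : V × U => x.1 ⊗ₜ[ℝ] x.2 := TensorProduct.continuous_tmul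
  exact h'.comp h

/-- The average squared coefficient of the sample along `e i ⊗ f j`. -/
def rectWeight {ι κ : Type*} (y : Fin n → V ⊗[ℝ] U) (e : ι → V) (f : κ → U) (i : ι) (j : κ) : ℝ :=
  (1 / (n : ℝ)) * ∑ k, inner ℝ (e i ⊗ₜ[ℝ] f j) (y k) ^ 2

theorem rectWeight_nonneg {ι κ : Type*} (y : Fin n → V ⊗[ℝ] U) (e : ι → V) (f : κ → U)
    (i : ι) (j : κ) : 0 ≤ rectWeight y e f i j :=
  mul_nonneg (by positivity) (Finset.sum_nonneg fun _ _ => sq_nonneg _)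

theorem rectWeight_pos {ι κ : Type*} {y : Fin n → V ⊗[ℝ] U} {e : ι → V} {f : κ → U}
    {i : ι} {j : κ} (h : ∃ k, inner ℝ (y k) (e i ⊗ₜ[ℝ] f j) ≠ 0) :
    0 < rectWeight y e f i j := by
  obtain ⟨k, hk⟩ := h
  have : 0 < n := Fin.pos k
  refine mul_pos (by positivity) (Finset.sum_pos' (fun _ _ => sq_nonneg _)
    ⟨k, Finset.mem_univ k, ?_⟩)
  exact lt_of_le_of_ne (sq_nonneg _) (pow_ne_zero 2 fun h =>
    hk ((real_inner_comm (F := V ⊗[ℝ] U) _ _).trans h)).symm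

theorem continuous_rectWeight {ι κ : Type*} (y : Fin n → V ⊗[ℝ] U) (i : ι) (j : κ) :
    Continuous fun z : (ι → V) × (κ → U) => rectWeight y z.1 z.2 i j := by
  have h := continuous_tmul_apply (V := V) (U := U) i j
  have h' : ∀ k, Continuous fun t : V ⊗[ℝ] U => inner ℝ t (y k) := fun k =>
    continuous_inner_const (E := V ⊗[ℝ] U) (y k)
  unfold rectWeight
  refine Continuous.mul continuous_const (continuous_finsetSum _ fun k _ => Continuous.pow ?_ 2)
  exact (h' k).comp h

theorem mapL_diagOp_mem_posDefOperators {ι κ : Type*} [Fintype ι] [Fintype κ]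
    (e : Module.Basis ι ℝ V) (f : Module.Basis κ ℝ U) {a : ι → ℝ} {b : κ → ℝ}
    (ha : ∀ i, 0 < a i) (hb : ∀ j, 0 < b j) :
    TensorProduct.mapL (diagOp e a) (diagOp f b) ∈ posDefOperators (V ⊗[ℝ] U) := by
  rw [mapL_diagOp]
  have h : (fun x : ι × κ => e x.1 ⊗ₜ[ℝ] f x.2) = e.tensorProduct f := by
    ext x
    rw [Module.Basis.tensorProduct_apply']
  rw [h]
  exact diagOp_mem_posDefOperators (e.tensorProduct f).span_eq.ge fun x => mul_pos (ha _) (hb _)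

theorem mapL_diagOp_mem_kroneckerCone {ι κ : Type*} [Fintype ι] [Fintype κ]
    {e : ι → V} {f : κ → U} (he : ⊤ ≤ Submodule.span ℝ (Set.range e))
    (hf : ⊤ ≤ Submodule.span ℝ (Set.range f)) {a : ι → ℝ} {b : κ → ℝ}
    (ha : ∀ i, 0 < a i) (hb : ∀ j, 0 < b j) :
    TensorProduct.mapL (diagOp e a) (diagOp f b) ∈ kroneckerCone V U :=
  ⟨_, diagOp_mem_posDefOperators he ha, _, diagOp_mem_posDefOperators hf hb, rfl⟩

variable [FiniteDimensional ℝ V] [FiniteDimensional ℝ U]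

theorem kroneckerCone_subset_posDefOperators : kroneckerCone V U ⊆ posDefOperators (V ⊗[ℝ] U) := by
  rintro _ ⟨P, hP, Q, hQ, rfl⟩
  obtain ⟨v, a, ha, rfl⟩ := exists_eq_diagOp hP
  obtain ⟨u, b, hb, rfl⟩ := exists_eq_diagOp hQ
  have := mapL_diagOp_mem_posDefOperators v.toBasis u.toBasis ha hb
  rwa [v.coe_toBasis, u.coe_toBasis] at this

theorem gaussianNLL_eq_add (hn : n ≠ 0) (x : Fin n → V ⊗[ℝ] U) (M : V ⊗[ℝ] U)
    (Θ : kroneckerCone V U) :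
    gaussianNLL x (M, Θ) = gaussianNLL x (sampleMean x, Θ) +
      inner ℝ ((Θ : V ⊗[ℝ] U →L[ℝ] V ⊗[ℝ] U) (sampleMean x - M)) (sampleMean x - M) := by
  have hΘ := kroneckerCone_subset_posDefOperators Θ.2
  unfold gaussianNLL
  simp only
  rw [sum_inner_sub_eq hn hΘ.1 x M]
  ring

/-- Arbitrary bases are allowed because simultaneous diagonalization is by congruence; the price is
a Gram term independent of the mean and the exponents. -/
theorem gaussianNLL_eq_sum {ι κ : Type*} [Fintype ι] [Fintype κ] [DecidableEq ι] [DecidableEq κ]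
    (x : Fin n → V ⊗[ℝ] U) (M : V ⊗[ℝ] U) (Θ : kroneckerCone V U)
    (e : Module.Basis ι ℝ V) (f : Module.Basis κ ℝ U) (a : ι → ℝ) (b : κ → ℝ)
    (hΘ : (Θ : V ⊗[ℝ] U →L[ℝ] V ⊗[ℝ] U) =
      TensorProduct.mapL (diagOp e fun i => Real.exp (a i)) (diagOp f fun j => Real.exp (b j))) :
    gaussianNLL x (M, Θ) =
      ∑ z : ι × κ, (rectWeight (fun k => x k - M) e f z.1 z.2 * Real.exp (a z.1 + b z.2) -
        (a z.1 + b z.2)) -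
      Real.log (Matrix.of fun z w : ι × κ =>
        inner ℝ (e.tensorProduct f z) (e.tensorProduct f w)).det := by
  have hdet := det_ne_zero_of_mem_posDefOperators (kroneckerCone_subset_posDefOperators Θ.2)
  unfold gaussianNLL
  simp only
  have h : (fun x : ι × κ => e x.1 ⊗ₜ[ℝ] f x.2) = e.tensorProduct f := by
    ext x
    rw [Module.Basis.tensorProduct_apply']
  have h' : (Θ : V ⊗[ℝ] U →L[ℝ] V ⊗[ℝ] U) =
      diagOp (e.tensorProduct f) fun z => Real.exp (a z.1 + b z.2) := by
    rw [hΘ, mapL_diagOp, h]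
    simp only [Real.exp_add]
  rw [h'] at hdet ⊢
  rw [det_diagOp] at hdet ⊢
  rw [Real.log_mul (left_ne_zero_of_mul hdet) (right_ne_zero_of_mul hdet), ← Real.exp_sum,
    Real.log_exp, Finset.sum_sub_distrib, ← sub_sub]
  congr 2
  simp only [inner_diagOp_self, rectWeight]
  rw [Finset.sum_comm, Finset.mul_sum]
  refine Finset.sum_congr rfl fun z _ => ?_
  rw [← Finset.mul_sum, Module.Basis.tensorProduct_apply']
  ring

/-- On a rectangle too large to be empty, the total weight is continuous and positive on the compact
set of pairs of orthonormal frames, hence bounded below. There are finitely many such rectangles, so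
one threshold serves all. -/
theorem IsStableTuple.exists_uniform {y : Fin n → V ⊗[ℝ] U} (hy : IsStableTuple y) :
    ∃ δ : ℝ, 0 < δ ∧ ∀ (e : Fin (Module.finrank ℝ V) → V) (f : Fin (Module.finrank ℝ U) → U),
      Orthonormal ℝ e → Orthonormal ℝ f → StrictHall fun i j => δ ≤ rectWeight y e f i j := by
  have key : ∀ (I : Finset (Fin (Module.finrank ℝ V))) (J : Finset (Fin (Module.finrank ℝ U))),
      ∀ᶠ δ : ℝ in nhdsWithin 0 (Set.Ioi 0),
        ∀ (e : Fin (Module.finrank ℝ V) → V) (f : Fin (Module.finrank ℝ U) → U),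
          Orthonormal ℝ e → Orthonormal ℝ f → I.Nonempty → J.Nonempty →
            (∀ i ∈ I, ∀ j ∈ J, ¬ δ ≤ rectWeight y e f i j) →
            I.card * Fintype.card (Fin (Module.finrank ℝ U)) +
              J.card * Fintype.card (Fin (Module.finrank ℝ V)) <
            Fintype.card (Fin (Module.finrank ℝ V)) * Fintype.card (Fin (Module.finrank ℝ U)) := by
    intro I J
    by_cases hIJ : I.Nonempty ∧ J.Nonempty ∧
        ¬ (I.card * Fintype.card (Fin (Module.finrank ℝ U)) +
              J.card * Fintype.card (Fin (Module.finrank ℝ V)) <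
            Fintype.card (Fin (Module.finrank ℝ V)) * Fintype.card (Fin (Module.finrank ℝ U)))
    swap
    · refine Filter.Eventually.of_forall fun δ e f _ _ hI hJ _ => ?_
      by_contra hc
      exact hIJ ⟨hI, hJ, hc⟩
    obtain ⟨hI, hJ, hcard⟩ := hIJ
    let g : (Fin (Module.finrank ℝ V) → V) × (Fin (Module.finrank ℝ U) → U) → ℝ :=
      fun z => ∑ i ∈ I, ∑ j ∈ J, rectWeight y z.1 z.2 i j
    have hg : Continuous g :=
      continuous_finsetSum _ fun i _ => continuous_finsetSum _ fun j _ =>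
        continuous_rectWeight y i j
    have hK : IsCompact ({e : Fin (Module.finrank ℝ V) → V | Orthonormal ℝ e} ×ˢ
        {f : Fin (Module.finrank ℝ U) → U | Orthonormal ℝ f}) :=
      isCompact_setOf_orthonormal.prod isCompact_setOf_orthonormal
    have hpos : ∀ z ∈ ({e : Fin (Module.finrank ℝ V) → V | Orthonormal ℝ e} ×ˢ
        {f : Fin (Module.finrank ℝ U) → U | Orthonormal ℝ f}), 0 < g z := by
      rintro ⟨e, f⟩ ⟨he, hf⟩
      have h1 : ∃ i ∈ I, ∃ j ∈ J, ∃ k, inner ℝ (y k) (e i ⊗ₜ[ℝ] f j) ≠ 0 := by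
        by_contra! hc
        refine hcard (hy e f (Orthonormal.linearIndependent he)
          (Orthonormal.linearIndependent hf) I J hI hJ ?_)
        rintro i hi j hj ⟨k, hk⟩
        exact hk (hc i hi j hj k)
      obtain ⟨i, hi, j, hj, hij⟩ := h1
      exact Finset.sum_pos' (fun _ _ => Finset.sum_nonneg fun _ _ => rectWeight_nonneg _ _ _ _ _)
        ⟨i, hi, Finset.sum_pos' (fun _ _ => rectWeight_nonneg _ _ _ _ _)
          ⟨j, hj, rectWeight_pos hij⟩⟩
    obtain ⟨c, hc0, hc⟩ : ∃ c : ℝ, 0 < c ∧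
        ∀ z ∈ ({e : Fin (Module.finrank ℝ V) → V | Orthonormal ℝ e} ×ˢ
          {f : Fin (Module.finrank ℝ U) → U | Orthonormal ℝ f}), c ≤ g z := by
      obtain ⟨z, hz, hmin⟩ := hK.exists_isMinOn
        ⟨(stdOrthonormalBasis ℝ V, stdOrthonormalBasis ℝ U),
          (stdOrthonormalBasis ℝ V).orthonormal, (stdOrthonormalBasis ℝ U).orthonormal⟩
        hg.continuousOn
      exact ⟨g z, hpos z hz, fun w hw => hmin hw⟩
    have hN : (0 : ℝ) < I.card * J.card := by
      have := hI.card_pos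
      have := hJ.card_pos
      positivity
    -- If all |I||J| weights were below such a δ, their sum would be below its minimum c.
    have hev : Set.Ioo (0 : ℝ) (c / (I.card * J.card)) ∈ nhdsWithin 0 (Set.Ioi (0 : ℝ)) :=
      Ioo_mem_nhdsGT (by positivity)
    filter_upwards [hev] with δ hδ e f he hf _ _ hlt
    exfalso
    have h1 : g (e, f) ≤ ∑ i ∈ I, ∑ j ∈ J, δ :=
      Finset.sum_le_sum fun i hi => Finset.sum_le_sum fun j hj => (not_le.1 (hlt i hi j hj)).le
    simp only [Finset.sum_const, nsmul_eq_mul] at h1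
    have h2 := hc (e, f) ⟨he, hf⟩
    have h3 := (lt_div_iff₀ hN).1 hδ.2
    nlinarith
  have hall := Filter.eventually_all.2 fun I => Filter.eventually_all.2 fun J => key I J
  obtain ⟨δ, hδ, hδ0⟩ := (hall.and self_mem_nhdsWithin).exists
  exact ⟨δ, hδ0, fun e f he hf I J hI hJ h => hδ I J e f he hf hI hJ h⟩

end Likelihood

/-! ### Continuity and compactness in the parameter space -/

section Abstract

variable {E : Type*} [NormedAddCommGroup E] [InnerProductSpace ℝ E] [FiniteDimensional ℝ E]

theorem continuous_quadratic_sub_log_det {S : Set (E →L[ℝ] E)} (hS : S ⊆ posDefOperators E) {n : ℕ}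
    (x : Fin n → E) : Continuous fun s : E × S =>
      (1 / (n : ℝ)) * ∑ i, inner ℝ ((s.2 : E →L[ℝ] E) (x i - s.1)) (x i - s.1) -
        Real.log (s.2 : E →L[ℝ] E).det := by
  refine Continuous.sub (by fun_prop) (Continuous.log ?_ fun s =>
    det_ne_zero_of_mem_posDefOperators (hS s.2.2))
  exact ContinuousLinearMap.continuous_det.comp (continuous_subtype_val.comp continuous_snd)

-- The image of `D` is compact in the ambient space of operators and stays inside `S`, so it is
-- compact in the subspace topology without `S` being closed.
omit [FiniteDimensional ℝ E] in
theorem isCompact_setOf_diagOp {S : Set (E →L[ℝ] E)} {Z ι : Type*} [TopologicalSpace Z] [Fintype ι]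
    {D : Set Z} (hD : IsCompact D) {M : Z → E} {g : Z → ι → E} {w : Z → ι → ℝ}
    (hM : Continuous M) (hg : Continuous g) (hw : Continuous w)
    (hS : ∀ z ∈ D, diagOp (g z) (w z) ∈ S) :
    IsCompact {s : E × S | ∃ z ∈ D, M z = s.1 ∧ diagOp (g z) (w z) = s.2} := by
  have hF : Continuous fun z => (M z, diagOp (g z) (w z)) :=
    hM.prodMk (continuous_diagOp.comp (hg.prodMk hw))
  have hind : Topology.IsInducing (Prod.map id Subtype.val : E × S → E × (E →L[ℝ] E)) :=
    Topology.IsInducing.id.prodMap Topology.IsInducing.subtypeVal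
  have hc := (hind.isCompact_preimage_iff (K := (fun z => (M z, diagOp (g z) (w z))) '' D) (by
    rintro _ ⟨z, hz, rfl⟩
    exact ⟨(M z, ⟨_, hS z hz⟩), rfl⟩)).2 (hD.image hF)
  convert hc using 1
  ext s
  simp [Prod.ext_iff]

end Abstract

/-! ### Compact sublevel sets and uniqueness -/

section Minimizer

variable {V U : Type*}
  [NormedAddCommGroup V] [InnerProductSpace ℝ V] [FiniteDimensional ℝ V]
  [NormedAddCommGroup U] [InnerProductSpace ℝ U] [FiniteDimensional ℝ U] {n : ℕ}

theorem continuous_gaussianNLL (x : Fin n → V ⊗[ℝ] U) : Continuous (gaussianNLL x) :=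
  continuous_quadratic_sub_log_det (E := V ⊗[ℝ] U) kroneckerCone_subset_posDefOperators x

/-- Operators with Kronecker-separable bounded log-eigenvalues, together with bounded means, form a
compact subset of the parameter space. -/
theorem isCompact_boundedParameters (M₀ : V ⊗[ℝ] U) (r C : ℝ) :
    IsCompact {s : (V ⊗[ℝ] U) × kroneckerCone V U | s.1 ∈ Metric.closedBall M₀ r ∧
      ∃ (e : Fin (Module.finrank ℝ V) → V) (f : Fin (Module.finrank ℝ U) → U)
        (a : Fin (Module.finrank ℝ V) → ℝ) (b : Fin (Module.finrank ℝ U) → ℝ),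
        Orthonormal ℝ e ∧ Orthonormal ℝ f ∧ (∀ i, |a i| ≤ C) ∧ (∀ j, |b j| ≤ C) ∧
        (s.2 : V ⊗[ℝ] U →L[ℝ] V ⊗[ℝ] U) = TensorProduct.mapL
          (diagOp e fun i => Real.exp (a i)) (diagOp f fun j => Real.exp (b j))} := by
  let Z := (V ⊗[ℝ] U) × (Fin (Module.finrank ℝ V) → V) × (Fin (Module.finrank ℝ U) → U) ×
      (Fin (Module.finrank ℝ V) → ℝ) × (Fin (Module.finrank ℝ U) → ℝ)
  let g : Z → Fin (Module.finrank ℝ V) × Fin (Module.finrank ℝ U) → V ⊗[ℝ] U :=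
    fun z x => z.2.1 x.1 ⊗ₜ[ℝ] z.2.2.1 x.2
  let w : Z → Fin (Module.finrank ℝ V) × Fin (Module.finrank ℝ U) → ℝ :=
    fun z x => Real.exp (z.2.2.2.1 x.1) * Real.exp (z.2.2.2.2 x.2)
  have hg : Continuous g := by
    refine continuous_pi fun x => ?_
    have h : Continuous fun z : Z => (z.2.1, z.2.2.1) := by fun_prop
    exact (continuous_tmul_apply x.1 x.2).comp h
  have hw : Continuous w := by fun_prop
  have hD := (isCompact_closedBall M₀ r).prod ((isCompact_setOf_orthonormal (E := V)
    (ι := Fin (Module.finrank ℝ V))).prod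
    ((isCompact_setOf_orthonormal (E := U) (ι := Fin (Module.finrank ℝ U))).prod
      ((isCompact_Icc (a := fun _ : Fin (Module.finrank ℝ V) => -C) (b := fun _ => C)).prod
        (isCompact_Icc (a := fun _ : Fin (Module.finrank ℝ U) => -C) (b := fun _ => C)))))
  have hc := isCompact_setOf_diagOp (E := V ⊗[ℝ] U) (S := kroneckerCone V U) hD
    (M := fun z : Z => z.1) continuous_fst hg hw (by
      rintro ⟨M, e, f, a, b⟩ ⟨hM, he, hf, ha, hb⟩
      have := mapL_diagOp_mem_kroneckerCone
        (he.linearIndependent.span_eq_top_of_card_eq_finrank' (Fintype.card_fin _)).ge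
        (hf.linearIndependent.span_eq_top_of_card_eq_finrank' (Fintype.card_fin _)).ge
        (fun i => Real.exp_pos (a i)) (fun j => Real.exp_pos (b j))
      rwa [mapL_diagOp] at this)
  convert hc using 1
  ext ⟨M, Θ⟩
  constructor
  · rintro ⟨hM, e, f, a, b, he, hf, ha, hb, h⟩
    refine ⟨(M, e, f, a, b), ⟨hM, he, hf, ⟨fun i => (abs_le.1 (ha i)).1,
      fun i => (abs_le.1 (ha i)).2⟩, ⟨fun j => (abs_le.1 (hb j)).1,
        fun j => (abs_le.1 (hb j)).2⟩⟩, rfl, ?_⟩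
    rw [mapL_diagOp] at h
    exact h.symm
  · rintro ⟨⟨M', e, f, a, b⟩, ⟨hM, he, hf, ha, hb⟩, h, h'⟩
    obtain rfl : M' = M := h
    refine ⟨hM, e, f, a, b, he, hf, fun i => abs_le.2 ⟨ha.1 i, ha.2 i⟩,
      fun j => abs_le.2 ⟨hb.1 j, hb.2 j⟩, ?_⟩
    rw [mapL_diagOp]
    exact h'.symm

variable [Nontrivial V] [Nontrivial U]

theorem gaussianNLL_le_subset_isCompact (hn : n ≠ 0) {x : Fin n → V ⊗[ℝ] U}
    (hx : IsStableTuple fun k => x k - sampleMean x) (A : ℝ) :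
    ∃ K : Set ((V ⊗[ℝ] U) × kroneckerCone V U), IsCompact K ∧
      ∀ s, gaussianNLL x s ≤ A → s ∈ K := by
  have : Nonempty (Fin (Module.finrank ℝ V)) := Fin.pos_iff_nonempty.1 Module.finrank_pos
  have : Nonempty (Fin (Module.finrank ℝ U)) := Fin.pos_iff_nonempty.1 Module.finrank_pos
  obtain ⟨δ, hδ, hH⟩ := hx.exists_uniform
  obtain ⟨C, hC⟩ := exists_bound_of_strictHall (Fin (Module.finrank ℝ V))
    (Fin (Module.finrank ℝ U)) hδ A
  -- The profiled likelihood is at least -C, leaving at most A + C for the quadratic term in the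
  -- mean, while Θ ≥ exp(-C). This gives the radius.
  refine ⟨_, isCompact_boundedParameters (sampleMean x)
    (Real.sqrt ((A + C) * Real.exp C)) (2 * C), ?_⟩
  rintro ⟨M, Θ⟩ hs
  have hΘ := kroneckerCone_subset_posDefOperators Θ.2
  obtain ⟨P, hP, Q, hQ, hPQ⟩ := Θ.2
  obtain ⟨v, a', ha', rfl⟩ := exists_eq_diagOp hP
  obtain ⟨u, b', hb', rfl⟩ := exists_eq_diagOp hQ
  obtain ⟨a, rfl⟩ : ∃ a : Fin (Module.finrank ℝ V) → ℝ, a' = fun i => Real.exp (a i) :=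
    ⟨fun i => Real.log (a' i), funext fun i => (Real.exp_log (ha' i)).symm⟩
  obtain ⟨b, rfl⟩ : ∃ b : Fin (Module.finrank ℝ U) → ℝ, b' = fun i => Real.exp (b i) :=
    ⟨fun i => Real.log (b' i), funext fun i => (Real.exp_log (hb' i)).symm⟩
  have hgram : (Matrix.of fun z w : Fin (Module.finrank ℝ V) × Fin (Module.finrank ℝ U) =>
      inner ℝ (v.toBasis.tensorProduct u.toBasis z) (v.toBasis.tensorProduct u.toBasis w)) = 1 := by
    ext z w
    rw [Matrix.of_apply, Module.Basis.tensorProduct_apply', Module.Basis.tensorProduct_apply',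
      TensorProduct.inner_tmul, v.coe_toBasis, u.coe_toBasis,
      orthonormal_iff_ite.1 v.orthonormal, orthonormal_iff_ite.1 u.orthonormal, Matrix.one_apply]
    by_cases h1 : z.1 = w.1 <;> by_cases h2 : z.2 = w.2 <;> simp [Prod.ext_iff, h1, h2]
  have hsum := gaussianNLL_eq_sum x (sampleMean x) Θ v.toBasis u.toBasis a b (by
    rw [v.coe_toBasis, u.coe_toBasis]; exact hPQ)
  rw [hgram, Matrix.det_one, Real.log_one, sub_zero, v.coe_toBasis, u.coe_toBasis] at hsum
  have hadd := gaussianNLL_eq_add hn x M Θ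
  set w := sampleMean x - M with hw
  have hquad : 0 ≤ inner ℝ ((Θ : V ⊗[ℝ] U →L[ℝ] V ⊗[ℝ] U) w) w := by
    by_cases hw0 : w = 0
    · rw [hw0, map_zero]
      exact (inner_zero_left (E := V ⊗[ℝ] U) _).ge
    · exact (hΘ.2 w hw0).le
  obtain ⟨hlow, hbd⟩ := hC (rectWeight (fun k => x k - sampleMean x) v u)
    (fun i j => rectWeight_nonneg _ _ _ _ _) (hH v u v.orthonormal u.orthonormal) a b
  have hab := hbd (by rw [← hsum]; linarith)
  obtain ⟨i₀⟩ := ‹Nonempty (Fin (Module.finrank ℝ V))›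
  obtain ⟨j₀⟩ := ‹Nonempty (Fin (Module.finrank ℝ U))›
  have hC0 : 0 ≤ C := (abs_nonneg _).trans (hab i₀ j₀)
  -- Only the sums a_i + b_j are bounded, since (P, Q) may be rescaled to (sP, Q/s). Normalizing at
  -- i₀ bounds each factor; a_i - a_i₀ is a difference of two such sums, hence 2C.
  refine ⟨?_, v, u, fun i => a i - a i₀, fun j => b j + a i₀, v.orthonormal, u.orthonormal,
    fun i => ?_, fun j => ?_, ?_⟩
  · have hw2 : Real.exp (-C) * ‖w‖ ^ 2 ≤ inner ℝ ((Θ : V ⊗[ℝ] U →L[ℝ] V ⊗[ℝ] U) w) w := by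
      have h1 : ‖w‖ ^ 2 = ∑ z, inner ℝ ((v.tensorProduct u) z) w ^ 2 :=
        ((v.tensorProduct u).sum_sq_inner_right w).symm
      have h2 : inner ℝ ((Θ : V ⊗[ℝ] U →L[ℝ] V ⊗[ℝ] U) w) w =
          ∑ z : Fin (Module.finrank ℝ V) × Fin (Module.finrank ℝ U),
            (Real.exp (a z.1) * Real.exp (b z.2)) * inner ℝ ((v.tensorProduct u) z) w ^ 2 := by
        rw [hPQ, mapL_diagOp]
        refine (inner_diagOp_self (E := V ⊗[ℝ] U) _ _ w).trans ?_
        simp only [OrthonormalBasis.tensorProduct_apply']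
      rw [h1, h2, Finset.mul_sum]
      refine Finset.sum_le_sum fun z _ => mul_le_mul_of_nonneg_right ?_ (sq_nonneg _)
      rw [← Real.exp_add]
      exact Real.exp_le_exp.2 (abs_le.1 (hab _ _)).1
    rw [Metric.mem_closedBall, dist_comm, dist_eq_norm, ← hw]
    refine Real.le_sqrt_of_sq_le ?_
    have h3 : Real.exp (-C) * ‖w‖ ^ 2 ≤ A + C := by linarith
    rwa [Real.exp_neg, inv_mul_le_iff₀ (Real.exp_pos _), mul_comm] at h3
  · have h1 := abs_le.1 (hab i j₀)
    have h2 := abs_le.1 (hab i₀ j₀)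
    rw [abs_le]
    constructor <;> linarith
  · have h1 := abs_le.1 (hab i₀ j)
    rw [abs_le]
    constructor <;> linarith
  · rw [hPQ, mapL_diagOp, mapL_diagOp]
    simp only [← Real.exp_add]
    congr 1
    ext z
    congr 1
    ring

theorem eq_of_forall_gaussianNLL_le (hn : n ≠ 0) {x : Fin n → V ⊗[ℝ] U}
    (hx : IsStableTuple fun k => x k - sampleMean x) {s t : (V ⊗[ℝ] U) × kroneckerCone V U}
    (hs : ∀ r, gaussianNLL x s ≤ gaussianNLL x r) (ht : ∀ r, gaussianNLL x t ≤ gaussianNLL x r) :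
    s = t := by
  have : Nonempty (Fin (Module.finrank ℝ V)) := Fin.pos_iff_nonempty.1 Module.finrank_pos
  have : Nonempty (Fin (Module.finrank ℝ U)) := Fin.pos_iff_nonempty.1 Module.finrank_pos
  have hmean : ∀ r : (V ⊗[ℝ] U) × kroneckerCone V U,
      (∀ r', gaussianNLL x r ≤ gaussianNLL x r') → r.1 = sampleMean x := by
    rintro ⟨M, Θ⟩ hr
    by_contra hne
    have h1 := hr (sampleMean x, Θ)
    have h2 := gaussianNLL_eq_add hn x M Θ
    have h3 := (kroneckerCone_subset_posDefOperators Θ.2).2 (sampleMean x - M)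
      (sub_ne_zero.2 (Ne.symm hne))
    have h4 : 0 < inner ℝ ((Θ : V ⊗[ℝ] U →L[ℝ] V ⊗[ℝ] U) (sampleMean x - M))
      (sampleMean x - M) := h3
    linarith
  obtain ⟨M₁, Θ₁⟩ := s
  obtain ⟨M₂, Θ₂⟩ := t
  obtain rfl : M₁ = sampleMean x := hmean _ hs
  obtain rfl : M₂ = sampleMean x := hmean _ ht
  obtain ⟨P₁, hP₁, Q₁, hQ₁, h₁⟩ := Θ₁.2
  obtain ⟨P₂, hP₂, Q₂, hQ₂, h₂⟩ := Θ₂.2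
  obtain ⟨e, a', ha', rfl, rfl⟩ := exists_simultaneous_diagOp hP₁ hP₂
  obtain ⟨f, b', hb', rfl, rfl⟩ := exists_simultaneous_diagOp hQ₁ hQ₂
  obtain ⟨a, rfl⟩ : ∃ a : Fin (Module.finrank ℝ V) → ℝ, a' = fun i => Real.exp (a i) :=
    ⟨fun i => Real.log (a' i), funext fun i => (Real.exp_log (ha' i)).symm⟩
  obtain ⟨b, rfl⟩ : ∃ b : Fin (Module.finrank ℝ U) → ℝ, b' = fun i => Real.exp (b i) :=
    ⟨fun i => Real.log (b' i), funext fun i => (Real.exp_log (hb' i)).symm⟩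
  have hone : ∀ m : ℕ, (1 : Fin m → ℝ) = fun i => Real.exp ((0 : Fin m → ℝ) i) := fun m => by
    ext i
    simp
  rw [hone, hone] at h₁
  -- The geodesic midpoint: Θ₁ has exponents 0 and Θ₂ has exponents a, b, so halving them stays in
  -- the Kronecker cone.
  let Θ : kroneckerCone V U := ⟨_, mapL_diagOp_mem_kroneckerCone e.span_eq.ge f.span_eq.ge
    (fun i => Real.exp_pos (a i / 2)) (fun j => Real.exp_pos (b j / 2))⟩
  have n1 := gaussianNLL_eq_sum x (sampleMean x) Θ₁ e f 0 0 h₁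
  have n2 := gaussianNLL_eq_sum x (sampleMean x) Θ₂ e f a b h₂
  have n3 := gaussianNLL_eq_sum x (sampleMean x) Θ e f (fun i => a i / 2) (fun j => b j / 2) rfl
  have l1 := hs (sampleMean x, Θ)
  have l2 := ht (sampleMean x, Θ)
  set c := rectWeight (fun k => x k - sampleMean x) e f with hc
  -- This sum is f(Θ₁) + f(Θ₂) - 2 f(Θ): the linear and Gram terms cancel, and minimality makes it
  -- nonpositive.
  have hzero : ∑ z : Fin (Module.finrank ℝ V) × Fin (Module.finrank ℝ U),
      c z.1 z.2 * (1 - Real.exp (a z.1 / 2 + b z.2 / 2)) ^ 2 ≤ 0 := by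
    have hterm : ∀ z : Fin (Module.finrank ℝ V) × Fin (Module.finrank ℝ U),
        c z.1 z.2 * (1 - Real.exp (a z.1 / 2 + b z.2 / 2)) ^ 2 =
        (c z.1 z.2 * Real.exp ((0 : Fin (Module.finrank ℝ V) → ℝ) z.1 +
          (0 : Fin (Module.finrank ℝ U) → ℝ) z.2) -
          ((0 : Fin (Module.finrank ℝ V) → ℝ) z.1 + (0 : Fin (Module.finrank ℝ U) → ℝ) z.2)) +
        (c z.1 z.2 * Real.exp (a z.1 + b z.2) - (a z.1 + b z.2)) -
        2 * (c z.1 z.2 * Real.exp (a z.1 / 2 + b z.2 / 2) - (a z.1 / 2 + b z.2 / 2)) := by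
      intro z
      have hE : Real.exp (a z.1 + b z.2) = Real.exp (a z.1 / 2 + b z.2 / 2) ^ 2 := by
        rw [← Real.exp_nat_mul]
        congr 1
        push_cast
        ring
      rw [hE]
      simp only [Pi.zero_apply, add_zero, Real.exp_zero]
      ring
    simp only [hterm, Finset.sum_sub_distrib, Finset.sum_add_distrib, ← Finset.mul_sum]
    simp only [Finset.sum_sub_distrib, Finset.sum_add_distrib] at n1 n2 n3
    linarith
  have hz := (Finset.sum_eq_zero_iff_of_nonneg fun z _ =>
    mul_nonneg (rectWeight_nonneg _ e f z.1 z.2) (sq_nonneg _)).1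
      (le_antisymm hzero (Finset.sum_nonneg fun z _ =>
        mul_nonneg (rectWeight_nonneg _ e f z.1 z.2) (sq_nonneg _)))
  -- These bases need not be orthonormal; this is where stability is needed for all linearly
  -- independent families.
  have hab := (hx e f e.linearIndependent f.linearIndependent).add_eq_zero a b
    fun i j hij => by
      have h1 := hz (i, j) (Finset.mem_univ _)
      have h2 := (mul_eq_zero.1 h1).resolve_left (rectWeight_pos hij).ne'
      have h3 : Real.exp (a i / 2 + b j / 2) = 1 := by
        have := pow_eq_zero_iff (two_ne_zero) |>.1 h2
        simp only at this
        linarith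
      have := Real.exp_eq_one_iff _ |>.1 h3
      linarith
  have hΘ : Θ₁ = Θ₂ := by
    apply Subtype.ext
    rw [h₁, h₂, mapL_diagOp, mapL_diagOp]
    simp only [← Real.exp_add, hab, Pi.zero_apply, add_zero]
  rw [hΘ]

end Minimizer

/-! ### From stability to the theorem -/

/-- Differences from the first observation are differences of centred observations, so a direction
orthogonal to all of the latter is orthogonal to the former. Genericity is easier for the former,
which are m = n - 1 free vectors. -/
theorem isStableTuple_sub_sampleMean {V U : Type*}
    [NormedAddCommGroup V] [InnerProductSpace ℝ V]
    [NormedAddCommGroup U] [InnerProductSpace ℝ U] {m : ℕ} {x : Fin (m + 1) → V ⊗[ℝ] U}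
    (hx : IsStableTuple fun k : Fin m => x k.succ - x 0) :
    IsStableTuple fun k => x k - sampleMean x := by
  intro e f he hf
  refine (hx e f he hf).mono fun i j hij => ?_
  by_contra! hc
  obtain ⟨k, hk⟩ := hij
  apply hk
  have h : x k.succ - x 0 = (x k.succ - sampleMean x) - (x 0 - sampleMean x) := by abel
  simp only
  rw [h, inner_sub_left, hc, hc, sub_zero]

theorem continuous_extendByTop {S : Type*} [TopologicalSpace S] [T2Space S] {f : S → ℝ}
    (hf : Continuous f) (hlim : Filter.Tendsto f (Filter.cocompact S) Filter.atTop) :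
    Continuous (extendByTop f) := by
  rw [continuous_iff_continuousAt]
  intro z
  induction z using OnePoint.rec with
  | infty =>
    rw [OnePoint.continuousAt_infty', Filter.coclosedCompact_eq_cocompact]
    change Filter.Tendsto (fun s => (f s : EReal)) _ (nhds ⊤)
    exact EReal.tendsto_coe_nhds_top_iff.2 hlim
  | coe s =>
    rw [OnePoint.continuousAt_coe]
    exact (continuous_coe_real_ereal.comp hf).continuousAt

/-- For a sample with stable deviations from the mean the likelihood is coercive and has exactly
one minimizer. -/
theorem continuous_extendByTop_and_existsUnique_minimizer {V U : Type*}
    [NormedAddCommGroup V] [InnerProductSpace ℝ V] [FiniteDimensional ℝ V] [Nontrivial V]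
    [NormedAddCommGroup U] [InnerProductSpace ℝ U] [FiniteDimensional ℝ U] [Nontrivial U]
    {n : ℕ} (hn0 : n ≠ 0) {x : Fin n → V ⊗[ℝ] U}
    (hst : IsStableTuple fun k => x k - sampleMean x) :
    Continuous (extendByTop (gaussianNLL x)) ∧
      ∃! s : (V ⊗[ℝ] U) × kroneckerCone V U,
        ∀ t : (V ⊗[ℝ] U) × kroneckerCone V U, gaussianNLL x s ≤ gaussianNLL x t := by
  have hcont := continuous_gaussianNLL x
  have hlim : Filter.Tendsto (gaussianNLL x)
      (Filter.cocompact ((V ⊗[ℝ] U) × kroneckerCone V U)) Filter.atTop := by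
    refine Filter.tendsto_atTop.2 fun A => ?_
    obtain ⟨K, hK, hKA⟩ := gaussianNLL_le_subset_isCompact hn0 hst A
    filter_upwards [hK.compl_mem_cocompact] with s hs
    by_contra hlt
    exact hs (hKA s (not_le.1 hlt).le)
  have hne : Nonempty ((V ⊗[ℝ] U) × kroneckerCone V U) :=
    ⟨(0, ⟨_, mapL_diagOp_mem_kroneckerCone (stdOrthonormalBasis ℝ V).toBasis.span_eq.ge
      (stdOrthonormalBasis ℝ U).toBasis.span_eq.ge (fun _ => one_pos) (fun _ => one_pos)⟩)⟩
  refine ⟨continuous_extendByTop hcont hlim, ?_⟩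
  obtain ⟨s, hs⟩ := hcont.exists_forall_le hlim
  exact ⟨s, hs, fun t ht => eq_of_forall_gaussianNLL_le hn0 hst ht hs⟩

end

theorem mainTheorem4
    {V U : Type*}
    [NormedAddCommGroup V] [InnerProductSpace ℝ V] [FiniteDimensional ℝ V] [Nontrivial V]
    [NormedAddCommGroup U] [InnerProductSpace ℝ U] [FiniteDimensional ℝ U] [Nontrivial U]
    [MeasurableSpace (V ⊗[ℝ] U)] [BorelSpace (V ⊗[ℝ] U)]
    {Ω : Type*} [MeasurableSpace Ω] (μ : Measure Ω) [IsProbabilityMeasure μ]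
    (p q n : ℕ) (hp : Module.finrank ℝ V = p) (hq : Module.finrank ℝ U = q)
    (hn : 1 + (p : ℝ) / q + (q : ℝ) / p < n)
    (X : Fin n → Ω → V ⊗[ℝ] U) (hX : JointlyContinuous X μ) :
    ∀ᵐ ω ∂μ,
      Continuous (extendByTop (gaussianNLL fun i => X i ω)) ∧
      ∃! s : (V ⊗[ℝ] U) × kroneckerCone V U,
        ∀ t : (V ⊗[ℝ] U) × kroneckerCone V U,
          gaussianNLL (fun i => X i ω) s ≤ gaussianNLL (fun i => X i ω) t := by
  have hp0 : (0 : ℝ) < p := by rw [← hp]; exact_mod_cast Module.finrank_pos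
  have hq0 : (0 : ℝ) < q := by rw [← hq]; exact_mod_cast Module.finrank_pos
  have hn0 : n ≠ 0 := by
    rintro rfl
    have : 0 < 1 + (p : ℝ) / q + (q : ℝ) / p := by positivity
    simp only [Nat.cast_zero] at hn
    linarith
  obtain ⟨m, rfl⟩ := Nat.exists_eq_succ_of_ne_zero hn0
  have hm : Module.finrank ℝ V ^ 2 + Module.finrank ℝ U ^ 2 <
      m * (Module.finrank ℝ V * Module.finrank ℝ U) := by
    rw [hp, hq]
    have h1 : (p : ℝ) / q + (q : ℝ) / p < m := by
      push_cast at hn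
      linarith
    rw [div_add_div _ _ hq0.ne' hp0.ne', div_lt_iff₀ (by positivity)] at h1
    have h2 : (p : ℝ) ^ 2 + (q : ℝ) ^ 2 < m * (p * q) := by linarith
    exact_mod_cast h2
  -- Absolute continuity of the joint law carries the Lebesgue-null exceptional set over to μ;
  -- independence plays no role.
  have hae : ∀ᵐ ω ∂μ, IsStableTuple fun k : Fin m => X k.succ ω - X 0 ω :=
    ae_of_ae_map hX.1 (hX.2.ae_le (ae_isStableTuple hm))
  refine hae.mono fun ω hω => ?_
  exact continuous_extendByTop_and_existsUnique_minimizer hn0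
    (isStableTuple_sub_sampleMean (x := fun i => X i ω) hω)
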